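/- Notation. Let $d,d_0\ge 1$ and $K\ge 1$ be integers, and let $\mathcal I_0,\mathcal O_0\cong\mathbb C^{d_0}$ and $\mathcal I_k,\mathcal O_k\cong\mathbb C^{d}$ ($1\le k\le K$). The Choi operator of a linear map $\Lambda$ is $J_\Lambda=\sum_{i,j}|i\rangle\langle j|\otimes\Lambda(|i\rangle\langle j|)$. A $K$-slot supermap is described by its Choi operator $C$ on $\mathcal I_0\otimes\bigotimes_k\mathcal I_k\otimes\bigotimes_k\mathcal O_k\otimes\mathcal O_0$; it sends the operations $\Lambda_k:L(\mathcal I_k)\to L(\mathcal O_k)$ in its slots to the operation $C(\Lambda_1\otimes\cdots\otimes\Lambda_K):L(\mathcal I_0)\to L(\mathcal O_0)$ with Choi operator $\mathrm{Tr}_{\mathcal I_1\cdots\mathcal I_K\mathcal O_1\cdots\mathcal O_K}[C\,(J_{\Lambda_1}\otimes\cdots\otimes J_{\Lambda_K})^T]$. It is a deterministic (sequential) comb if $C\ge 0$, $\mathrm{Tr}\,C=d_0d^K$ and $$\mathrm{Tr}_{\mathcal O_0}C=C^{(K)}\otimes\tfrac{I^{\mathcal O_K}}{d},\qquad \mathrm{Tr}_{\mathcal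 I_k}C^{(k)}=C^{(k-1)}\otimes\tfrac{I^{\mathcal O_{k-1}}}{d}\ (2\le k\le K),\qquad \mathrm{Tr}_{\mathcal I_1}C^{(1)}=(\mathrm{Tr}\,C)\tfrac{I^{\mathcal I_0}}{d_0},$$ where $C^{(K)}=\mathrm{Tr}_{\mathcal O_K\mathcal O_0}C$ and $C^{(k-1)}=\mathrm{Tr}_{\mathcal O_{k-1}\mathcal I_k}C^{(k)}$. A probabilistic comb is an $S\ge0$ for which some $F\ge 0$ makes $S+F$ a deterministic comb. For a unitary $U$ on $\mathbb C^d$, $\widetilde U$ denotes the operation $\rho\mapsto U\rho U^\dagger$. Theorem. Let $S_1$ be a one-slot probabilistic comb such that, for every unitary $U$ on $\mathbb C^d$, $S_1(\widetilde U)=p_U f(U)$ with $p_U$ a real number and $f(U):L(\mathbb C^{d_0})\to L(\mathbb C^{d_0})$ a completely positive trace-preserving map. Then there exist $\varepsilon>0$ (independent of $U$) and $d$-slot probabilistic combs $S$ and $N$ such that $S+N$ is a deterministic comb and, for every unitary $U$ on $\mathbb C^d$, $$S(\widetilde U^{\otimes d})=\varepsilon\,p_U\,f(U),\qquad N(\widetilde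 U^{\otimes d})=(1-\varepsilon\,p_U)\,\mathrm{id}.$$ Moreover $S$ and $N$ can be chosen so that the comb has depth two, i.e. one call of $U$ followed by $d-1$ calls in parallel: $$\mathrm{Tr}_{\mathcal O_0}(S+N)=\mathrm{Tr}_{\mathcal O_2\cdots\mathcal O_d\mathcal O_0}(S+N)\otimes\frac{I_{\mathcal O_2\cdots\mathcal O_d}}{d^{\,d-1}}.$$ -/

import Mathlib

open scoped ComplexOrder

namespace QComb

noncomputable section

/-- Linear maps `L(ℂ^m) → L(ℂ^n)` (candidates for quantum operations). -/
abbrev Op (m n : ℕ) : Type :=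
  Matrix (Fin m) (Fin m) ℂ →ₗ[ℂ] Matrix (Fin n) (Fin n) ℂ

/-- Complete positivity: `id_k ⊗ Λ` preserves positive semidefiniteness for every ancilla
dimension `k`. -/
def IsCompletelyPositive {m n : ℕ} (Λ : Op m n) : Prop :=
  ∀ (k : ℕ) (X : Matrix (Fin k × Fin m) (Fin k × Fin m) ℂ), X.PosSemidef →
    (Matrix.of fun (x y : Fin k × Fin n) =>
      Λ (Matrix.of fun a b => X (x.1, a) (y.1, b)) x.2 y.2).PosSemidef

/-- Completely positive and trace-preserving maps. -/
def IsCPTP {m n : ℕ} (Λ : Op m n) : Prop :=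
  IsCompletelyPositive Λ ∧ ∀ ρ, (Λ ρ).trace = ρ.trace

/-- The unitary operation `ρ ↦ U ρ U†`. -/
def unitaryOp {d : ℕ} (U : Matrix.unitaryGroup (Fin d) ℂ) : Op d d :=
  LinearMap.mulLeftRight ℂ
    ((U : Matrix (Fin d) (Fin d) ℂ), star (U : Matrix (Fin d) (Fin d) ℂ))

/-- The Choi operator `J_Λ = ∑ i j, |i⟩⟨j| ⊗ Λ(|i⟩⟨j|)` on input ⊗ output. -/
def choi {m n : ℕ} (Λ : Op m n) : Matrix (Fin m × Fin n) (Fin m × Fin n) ℂ :=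
  Matrix.of fun x y => Λ (Matrix.single x.1 y.1 1) x.2 y.2

/-- The linear map with Choi operator `M`: `ρ ↦ Tr_in [M (ρᵀ ⊗ I)]`. -/
def ofChoi {m n : ℕ} (M : Matrix (Fin m × Fin n) (Fin m × Fin n) ℂ) : Op m n where
  toFun ρ := Matrix.of fun b b' => ∑ a, ∑ a', M (a, b) (a', b') * ρ a a'
  map_add' ρ σ := by
    ext b b'
    simp [mul_add, Finset.sum_add_distrib]
  map_smul' c ρ := by
    ext b b'
    simp [Finset.mul_sum, mul_left_comm]

/-- Basis labels of `I₀ ⊗ (I₁ ⋯ I_K) ⊗ (O₁ ⋯ O_K) ⊗ O₀`, with `dim I₀ = dim O₀ = d₀` and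
`dim I_k = dim O_k = d` for the `K` slots. The `k`-th slot is filled by an operation from
`I_k` to `O_k`. -/
abbrev CombIdx (d d₀ K : ℕ) : Type :=
  Fin d₀ × (Fin K → Fin d) × (Fin K → Fin d) × Fin d₀

/-- Basis labels of `I₀ ⊗ (I₁ ⋯ I_m) ⊗ (O₁ ⋯ O_n)`. -/
abbrev PartIdx (d d₀ m n : ℕ) : Type :=
  Fin d₀ × (Fin m → Fin d) × (Fin n → Fin d)

/-- Choi operators of `K`-slot supermaps. -/
abbrev CombOp (d d₀ K : ℕ) : Type :=
  Matrix (CombIdx d d₀ K) (CombIdx d d₀ K) ℂ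

/-- Operators on `I₀ ⊗ (I₁ ⋯ I_m) ⊗ (O₁ ⋯ O_n)`. -/
abbrev PartOp (d d₀ m n : ℕ) : Type :=
  Matrix (PartIdx d d₀ m n) (PartIdx d d₀ m n) ℂ

/-- The Choi operator `Tr_{I O} [C (J_{Λ₁} ⊗ ⋯ ⊗ J_{Λ_K})ᵀ]` on `I₀ ⊗ O₀` of the operation that
the supermap `C` outputs when `Λ k` is inserted in its `k`-th slot. -/
def actChoi {d d₀ K : ℕ} (C : CombOp d d₀ K) (Λ : Fin K → Op d d) :
    Matrix (Fin d₀ × Fin d₀) (Fin d₀ × Fin d₀) ℂ :=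
  Matrix.of fun x y =>
    ∑ i : Fin K → Fin d, ∑ o : Fin K → Fin d, ∑ i' : Fin K → Fin d, ∑ o' : Fin K → Fin d,
      C (x.1, i, o, x.2) (y.1, i', o', y.2) * ∏ k, choi (Λ k) (i k, o k) (i' k, o' k)

/-- The operation that the supermap `C` outputs when `Λ k` is inserted in its `k`-th slot. -/
def act {d d₀ K : ℕ} (C : CombOp d d₀ K) (Λ : Fin K → Op d d) : Op d₀ d₀ :=
  ofChoi (actChoi C Λ)

/-- `Tr_{O₀} C`. -/
def traceO₀ {d d₀ K : ℕ} (C : CombOp d d₀ K) : PartOp d d₀ K K :=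
  Matrix.of fun x y => ∑ c, C (x.1, x.2.1, x.2.2, c) (y.1, y.2.1, y.2.2, c)

/-- Partial trace over the last output space `O_{n+1}`. -/
def traceLastO {d d₀ m n : ℕ} (T : PartOp d d₀ m (n + 1)) : PartOp d d₀ m n :=
  Matrix.of fun x y => ∑ c : Fin d,
    T (x.1, x.2.1, Fin.snoc (α := fun _ => Fin d) x.2.2 c)
      (y.1, y.2.1, Fin.snoc (α := fun _ => Fin d) y.2.2 c)

/-- Partial trace over the last input space `I_{m+1}`. -/
def traceLastI {d d₀ m n : ℕ} (T : PartOp d d₀ (m + 1) n) : PartOp d d₀ m n :=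
  Matrix.of fun x y => ∑ c : Fin d,
    T (x.1, Fin.snoc (α := fun _ => Fin d) x.2.1 c, x.2.2)
      (y.1, Fin.snoc (α := fun _ => Fin d) y.2.1 c, y.2.2)

/-- `T ⊗ I^{O_{n+1}} / d`. -/
def tensorMaxMixedO {d d₀ m n : ℕ} (T : PartOp d d₀ m n) : PartOp d d₀ m (n + 1) :=
  Matrix.of fun x y =>
    T (x.1, x.2.1, Fin.init x.2.2) (y.1, y.2.1, Fin.init y.2.2) *
      (if x.2.2 (Fin.last n) = y.2.2 (Fin.last n) then (d : ℂ)⁻¹ else 0)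

/-- The causal conditions of a sequential comb, for an operator on
`I₀ I₁ ⋯ I_n O₁ ⋯ O_n` (all later spaces having been traced out). With
`C^{(n)} = Tr_{O_n} T` they read `T = C^{(n)} ⊗ I^{O_n} / d`, and the same again for
`Tr_{I_n} C^{(n)}`, down to `T = (Tr T) I^{I₀} / d₀` when only `I₀` is left. -/
def IsCausal {d d₀ : ℕ} : (n : ℕ) → PartOp d d₀ n n → Prop
  | 0, T => T = (T.trace / (d₀ : ℂ)) • (1 : PartOp d d₀ 0 0)
  | n + 1, T => T = tensorMaxMixedO (traceLastO T) ∧ IsCausal n (traceLastI (traceLastO T))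

/-- Choi operators of deterministic (sequential) `K`-slot combs: positivity, the causal conditions
and the normalization `Tr C = d₀ d^K`. -/
def IsDeterministicComb {d d₀ K : ℕ} (C : CombOp d d₀ K) : Prop :=
  C.PosSemidef ∧ IsCausal K (traceO₀ C) ∧ C.trace = (d₀ : ℂ) * (d : ℂ) ^ K

/-- Choi operators of probabilistic `K`-slot combs: those which some positive operator completes to
a deterministic comb. -/
def IsProbabilisticComb {d d₀ K : ℕ} (S : CombOp d d₀ K) : Prop :=
  S.PosSemidef ∧ ∃ F : CombOp d d₀ K, F.PosSemidef ∧ IsDeterministicComb (S + F)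

/-- The label of `O₁ ⋯ O_K` that agrees with `o` on the first space and with `c` on the others. -/
def replaceTail {d K : ℕ} (o : Fin K → Fin d) (c : {k : Fin K // k.val ≠ 0} → Fin d) :
    Fin K → Fin d :=
  fun k => if h : k.val = 0 then o k else c ⟨k, h⟩

/-- The depth-two condition
`Tr_{O₀} C = Tr_{O₂ ⋯ O_K O₀} C ⊗ I_{O₂ ⋯ O_K} / d^{K-1}`.
For a sequential comb it says that the first slot is used first, and that the remaining `K - 1`
slots are then used in parallel. -/
def IsDepthTwo {d d₀ K : ℕ} (C : CombOp d d₀ K) : Prop :=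
  ∀ x y : PartIdx d d₀ K K,
    traceO₀ C x y =
      (∑ c : {k : Fin K // k.val ≠ 0} → Fin d,
        traceO₀ C (x.1, x.2.1, replaceTail x.2.2 c) (y.1, y.2.1, replaceTail y.2.2 c)) *
      (if ∀ k : Fin K, k.val ≠ 0 → x.2.2 k = y.2.2 k then ((d : ℂ) ^ (K - 1))⁻¹ else 0)

end

end QComb

namespace QComb

open scoped Kronecker

/-! Let `T a b` be the blocks of `Tr_{O₀} S₁`, operators on `I₁ ⊗ O₁`. As `f(U)` preserves the
trace, contracting `T a b` with the Choi operator of `U` gives `δ_{ab} p_U`. For a fixed diagonal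
block `T₀`, the operator `T a b - δ_{ab} T₀` is therefore annihilated by every unitary channel.
Polarization over unitaries (`mul_apply_of_choiForm`) forces it to be `A ⊗ 1 + 1 ⊗ B`, with `A`
traceless on `I₁` and `B` traceless on `O₁`. The `A`-term is compatible with causality; the `B`-term
is not, and the draw branch has to cancel it.

The success branch is `κ S₁` with the other slots idle. The draw branch has two terms. One passes
`I₀` directly to `O₀`, with an operator `M` on the slots that contains `-κ T₀`. The other, of weight
`w`, feeds the slots with the totally antisymmetric state `α` of `d` systems, which `U^{⊗d}` only
multiplies by `det U` (hence `d` calls), and then acts on `I₀` and the outputs by an operation whose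
marginal is `1 - η B`.

That operation still returns the input exactly. Let `K` be the isometry appending `α`. Since the
first marginal of `α` is maximally mixed and `Tr_{O₁} B = 0`, one has `Kᴴ B K = 0`, so the Kraus
operator `(1 - η B) K` satisfies `Kᴴ (1 - η B) K = 1`. The missing part of the marginal,
`failBlock`, is positive for small `η` and vanishes on the range of `K`. With `w η = d ε` the
`B`-terms cancel once the inputs `I₂, …, I_d` are traced out. All later outputs carry identities,
which gives both causality (`isCausal_of_tail`) and depth two. -/

/-! ### Operators annihilated by all unitary channels -/

/-- The sesquilinear form on matrices whose values on unitaries `U` are the contractions of `Q` with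
the Choi operator of `U`. -/
noncomputable def choiForm {d : ℕ} (Q : Matrix (Fin d × Fin d) (Fin d × Fin d) ℂ) :
    Matrix (Fin d) (Fin d) ℂ →ₗ[ℂ] Matrix (Fin d) (Fin d) ℂ →ₛₗ[starRingEnd ℂ] ℂ :=
  LinearMap.mk₂'ₛₗ (RingHom.id ℂ) (starRingEnd ℂ)
    (fun X Y => ∑ x, ∑ y, Q x y * (X x.2 x.1 * star (Y y.2 y.1)))
    (by intros; simp [add_mul, mul_add, Finset.sum_add_distrib])
    (by intros; simp [Finset.mul_sum]; exact Finset.sum_congr rfl fun _ _ =>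
      Finset.sum_congr rfl fun _ _ => by ring)
    (by intros; simp [mul_add, Finset.sum_add_distrib])
    (by intros; simp [Finset.mul_sum]; exact Finset.sum_congr rfl fun _ _ =>
      Finset.sum_congr rfl fun _ _ => by ring)

theorem choiForm_apply {d : ℕ} (Q : Matrix (Fin d × Fin d) (Fin d × Fin d) ℂ)
    (X Y : Matrix (Fin d) (Fin d) ℂ) :
    choiForm Q X Y = ∑ x, ∑ y, Q x y * (X x.2 x.1 * star (Y y.2 y.1)) := rfl

theorem choiForm_single {d : ℕ} (Q : Matrix (Fin d × Fin d) (Fin d × Fin d) ℂ)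
    (i o i' o' : Fin d) :
    choiForm Q (Matrix.single o i 1) (Matrix.single o' i' 1) = Q (i, o) (i', o') := by
  rw [choiForm_apply, Finset.sum_eq_single (i, o), Finset.sum_eq_single (i', o')]
  · simp
  · rintro ⟨a, b⟩ - h
    have h0 : Matrix.single o' i' (1 : ℂ) b a = 0 := by
      rw [Matrix.single_apply, if_neg fun hh => h (Prod.ext hh.2.symm hh.1.symm)]
    simp [h0]
  · simp
  · rintro ⟨a, b⟩ - h
    have h0 : Matrix.single o i (1 : ℂ) b a = 0 := by
      rw [Matrix.single_apply, if_neg fun hh => h (Prod.ext hh.2.symm hh.1.symm)]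
    simp [h0]
  · simp

/-- Phase polarization: cross terms of a sesquilinear form that vanishes on all rephasings
vanish. -/
theorem sesq_cross_eq_zero {V : Type*} [AddCommGroup V] [Module ℂ V]
    (F : V →ₗ[ℂ] V →ₛₗ[starRingEnd ℂ] ℂ) (R X Y : V)
    (h : ∀ s t : ℂ, star s * s = 1 → star t * t = 1 →
      F (R + s • X + t • Y) (R + s • X + t • Y) = 0) : F X Y = 0 := by
  have h1 := h 1 1 (by simp) (by simp)
  have h2 := h 1 (-1) (by simp) (by simp)
  have h3 := h (-1) 1 (by simp) (by simp)
  have h4 := h (-1) (-1) (by simp) (by simp)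
  have h5 := h Complex.I 1 (by simp) (by simp)
  have h6 := h Complex.I (-1) (by simp) (by simp)
  have h7 := h (-Complex.I) 1 (by simp) (by simp)
  have h8 := h (-Complex.I) (-1) (by simp) (by simp)
  simp only [map_add, map_smul, LinearMap.add_apply, LinearMap.smul_apply, map_smulₛₗ,
    smul_eq_mul, map_one, map_neg, Complex.conj_I] at h1 h2 h3 h4 h5 h6 h7 h8
  -- Signs `s, t = ±1` isolate `F X Y + F Y X`; the choices `s = ±i`, `t = ±1` isolate `F X Y - F Y
  -- X` up to a factor `i`.
  linear_combination (1/8 : ℂ) * (h1 - h2 - h3 + h4) - (Complex.I/8) * (h5 - h6 - h7 + h8) +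
    (F X Y - F Y X) / 2 * Complex.I_mul_I

theorem exists_unitary_cols {d : ℕ} (k l : Fin d) (hkl : k ≠ l) (v v' : Fin d → ℂ)
    (hv : star v ⬝ᵥ v = 1) (hv' : star v' ⬝ᵥ v' = 1) (hvv' : star v ⬝ᵥ v' = 0) :
    ∃ W ∈ Matrix.unitaryGroup (Fin d) ℂ, (∀ a, W a k = v a) ∧ ∀ a, W a l = v' a := by
  classical
  let w : Fin d → EuclideanSpace ℂ (Fin d) := fun j =>
    if j = k then WithLp.toLp 2 v else WithLp.toLp 2 v'
  have hin : ∀ x y : Fin d → ℂ, inner ℂ (WithLp.toLp 2 x) (WithLp.toLp 2 y) = star x ⬝ᵥ y := by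
    intro x y
    rw [EuclideanSpace.inner_toLp_toLp, dotProduct_comm]
  have hv'v : star v' ⬝ᵥ v = 0 := by
    rw [← star_star (star v' ⬝ᵥ v), ← Matrix.star_dotProduct, hvv', star_zero]
  have hw : Orthonormal ℂ (({k, l} : Set (Fin d)).domRestrict w) := by
    rw [orthonormal_iff_ite]
    rintro ⟨i, hi⟩ ⟨j, hj⟩
    have hwk : w k = WithLp.toLp 2 v := if_pos rfl
    have hwl : w l = WithLp.toLp 2 v' := if_neg hkl.symm
    rw [Set.domRestrict_apply, Set.domRestrict_apply]
    rcases hi with rfl | rfl <;> rcases hj with rfl | rfl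
    · rw [hwk, hin, hv, if_pos rfl]
    · rw [hwk, hwl, hin, hvv', if_neg fun h => hkl (Subtype.ext_iff.1 h)]
    · rw [hwk, hwl, hin, hv'v, if_neg fun h => hkl (Subtype.ext_iff.1 h).symm]
    · rw [hwl, hin, hv', if_pos rfl]
  obtain ⟨b, hb⟩ := hw.exists_orthonormalBasis_extension_of_card_eq (by simp)
  refine ⟨(EuclideanSpace.basisFun (Fin d) ℂ).toBasis.toMatrix b,
    (EuclideanSpace.basisFun (Fin d) ℂ).toMatrix_orthonormalBasis_mem_unitary b, ?_, ?_⟩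
  · intro a
    simp [Module.Basis.toMatrix_apply, hb k (by simp), w]
  · intro a
    simp [Module.Basis.toMatrix_apply, hb l (by simp), w, hkl.symm]

/-- The two rank-one matrices are two terms of a singular value decomposition of a unitary `W₁ *
diagonal z * W₂ᵀ`. Their phases `s` and `t` in `z` can be varied freely, so polarization applies. -/
theorem choiForm_vecMulVec_orthonormal {d : ℕ} {Q : Matrix (Fin d × Fin d) (Fin d × Fin d) ℂ}
    (hQ : ∀ U ∈ Matrix.unitaryGroup (Fin d) ℂ, choiForm Q U U = 0)
    (k l : Fin d) (hkl : k ≠ l) (v v' u u' : Fin d → ℂ)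
    (hv : star v ⬝ᵥ v = 1) (hv' : star v' ⬝ᵥ v' = 1) (hvv' : star v ⬝ᵥ v' = 0)
    (hu : star u ⬝ᵥ u = 1) (hu' : star u' ⬝ᵥ u' = 1) (huu' : star u ⬝ᵥ u' = 0) :
    choiForm Q (Matrix.vecMulVec v u) (Matrix.vecMulVec v' u') = 0 := by
  obtain ⟨W₁, hW₁, h1k, h1l⟩ := exists_unitary_cols k l hkl v v' hv hv' hvv'
  obtain ⟨W₂, hW₂, h2k, h2l⟩ := exists_unitary_cols k l hkl u u' hu hu' huu'
  have hW₂t : W₂.transpose ∈ Matrix.unitaryGroup (Fin d) ℂ := by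
    rw [Matrix.mem_unitaryGroup_iff']
    rw [Matrix.mem_unitaryGroup_iff] at hW₂
    have := congrArg Matrix.transpose hW₂
    rw [Matrix.transpose_mul, Matrix.transpose_one] at this
    exact this
  have key : ∀ z : Fin d → ℂ, W₁ * Matrix.diagonal z * W₂.transpose =
      ∑ m, z m • Matrix.vecMulVec (fun a => W₁ a m) (fun a => W₂ a m) := by
    intro z
    ext a b
    simp [Matrix.mul_apply, Matrix.sum_apply, Matrix.vecMulVec_apply, Matrix.diagonal_apply]
    exact Finset.sum_congr rfl fun _ _ => by ring
  have hk : Matrix.vecMulVec (fun a => W₁ a k) (fun a => W₂ a k) = Matrix.vecMulVec v u := by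
    ext; simp [Matrix.vecMulVec_apply, h1k, h2k]
  have hl : Matrix.vecMulVec (fun a => W₁ a l) (fun a => W₂ a l) = Matrix.vecMulVec v' u' := by
    ext; simp [Matrix.vecMulVec_apply, h1l, h2l]
  refine sesq_cross_eq_zero (choiForm Q) (∑ m ∈ (Finset.univ.erase k).erase l,
    Matrix.vecMulVec (fun a => W₁ a m) (fun a => W₂ a m)) _ _ fun s t hs ht => ?_
  let z : Fin d → ℂ := fun m => if m = k then s else if m = l then t else 1
  have hz : (∑ m ∈ (Finset.univ.erase k).erase l,
      Matrix.vecMulVec (fun a => W₁ a m) (fun a => W₂ a m)) + s • Matrix.vecMulVec v u +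
      t • Matrix.vecMulVec v' u' = W₁ * Matrix.diagonal z * W₂.transpose := by
    rw [key, ← Finset.add_sum_erase _ _ (Finset.mem_univ k),
      ← Finset.add_sum_erase _ _ (Finset.mem_erase.2 ⟨hkl.symm, Finset.mem_univ l⟩), hk, hl]
    have : ∑ m ∈ (Finset.univ.erase k).erase l,
        z m • Matrix.vecMulVec (fun a => W₁ a m) (fun a => W₂ a m) =
        ∑ m ∈ (Finset.univ.erase k).erase l,
          Matrix.vecMulVec (fun a => W₁ a m) (fun a => W₂ a m) := by
      refine Finset.sum_congr rfl fun m hm => ?_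
      simp only [Finset.mem_erase] at hm
      simp [z, hm.1, hm.2.1]
    rw [this]
    simp only [z, if_true, hkl.symm, if_false]
    abel
  rw [hz]
  refine hQ _ (mul_mem (mul_mem hW₁ ?_) hW₂t)
  rw [Matrix.mem_unitaryGroup_iff', Matrix.star_eq_conjTranspose, Matrix.diagonal_conjTranspose,
    Matrix.diagonal_mul_diagonal, ← Matrix.diagonal_one]
  congr 1
  ext m
  simp only [z, Pi.star_apply]
  split_ifs <;> simp_all

theorem exists_smul_unit {d : ℕ} (v : Fin d → ℂ) (hv : v ≠ 0) :
    ∃ (c : ℂ) (w : Fin d → ℂ), c ≠ 0 ∧ star w ⬝ᵥ w = 1 ∧ v = c • w := by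
  have hn : ‖WithLp.toLp 2 v‖ ≠ 0 := by simpa using hv
  refine ⟨‖WithLp.toLp 2 v‖, (‖WithLp.toLp 2 v‖ : ℂ)⁻¹ • v, by exact_mod_cast hn, ?_, ?_⟩
  · have : star v ⬝ᵥ v = (‖WithLp.toLp 2 v‖ : ℂ) ^ 2 := by
      rw [dotProduct_comm, ← EuclideanSpace.inner_toLp_toLp, inner_self_eq_norm_sq_to_K]
      rfl
    rw [star_smul, smul_dotProduct, dotProduct_smul, this]
    simp only [smul_eq_mul, star_inv₀, RCLike.star_def, Complex.conj_ofReal]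
    have : (‖WithLp.toLp 2 v‖ : ℂ) ≠ 0 := by exact_mod_cast hn
    field_simp
  · rw [smul_smul, mul_inv_cancel₀ (by exact_mod_cast hn), one_smul]

theorem choiForm_vecMulVec {d : ℕ} {Q : Matrix (Fin d × Fin d) (Fin d × Fin d) ℂ}
    (hQ : ∀ U ∈ Matrix.unitaryGroup (Fin d) ℂ, choiForm Q U U = 0)
    (k l : Fin d) (hkl : k ≠ l) (v v' u u' : Fin d → ℂ)
    (hvv' : star v ⬝ᵥ v' = 0) (huu' : star u ⬝ᵥ u' = 0) :
    choiForm Q (Matrix.vecMulVec v u) (Matrix.vecMulVec v' u') = 0 := by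
  by_cases h1 : v = 0
  · simp [h1]
  by_cases h2 : v' = 0
  · simp [h2]
  by_cases h3 : u = 0
  · simp [h3]
  by_cases h4 : u' = 0
  · simp [h4]
  obtain ⟨c₁, w₁, hc₁, hw₁, rfl⟩ := exists_smul_unit v h1
  obtain ⟨c₂, w₂, hc₂, hw₂, rfl⟩ := exists_smul_unit v' h2
  obtain ⟨c₃, w₃, hc₃, hw₃, rfl⟩ := exists_smul_unit u h3
  obtain ⟨c₄, w₄, hc₄, hw₄, rfl⟩ := exists_smul_unit u' h4
  have := choiForm_vecMulVec_orthonormal hQ k l hkl w₁ w₂ w₃ w₄ hw₁ hw₂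
    (by simpa [hc₁, hc₂] using hvv') hw₃ hw₄ (by simpa [hc₃, hc₄] using huu')
  simp [Matrix.smul_vecMulVec, Matrix.vecMulVec_smul, this]

section
variable {d : ℕ} {Q : Matrix (Fin d × Fin d) (Fin d × Fin d) ℂ}

theorem apply_eq_zero_of_choiForm
    (hQ : ∀ U ∈ Matrix.unitaryGroup (Fin d) ℂ, choiForm Q U U = 0)
    {i i' o o' : Fin d} (hi : i ≠ i') (ho : o ≠ o') : Q (i, o) (i', o') = 0 := by
  have := choiForm_vecMulVec hQ i i' hi (Pi.single o 1) (Pi.single o' 1) (Pi.single i 1)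
    (Pi.single i' 1) (by simp [ho.symm]) (by simp [hi.symm])
  simpa [← Matrix.single_eq_single_vecMulVec_single, choiForm_single] using this

theorem apply_eq_of_choiForm_left
    (hQ : ∀ U ∈ Matrix.unitaryGroup (Fin d) ℂ, choiForm Q U U = 0)
    {i i' : Fin d} (o o' : Fin d) (hi : i ≠ i') : Q (i, o) (i', o) = Q (i, o') (i', o') := by
  rcases eq_or_ne o o' with rfl | ho
  · rfl
  have := choiForm_vecMulVec hQ i i' hi (Pi.single o 1 + Pi.single o' 1)
    (Pi.single o 1 - Pi.single o' 1) (Pi.single i 1)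
    (Pi.single i' 1) (by simp [ho, ho.symm]) (by simp [hi.symm])
  simp only [Matrix.add_vecMulVec, Matrix.sub_vecMulVec, map_add, map_sub, LinearMap.add_apply,
    ← Matrix.single_eq_single_vecMulVec_single, choiForm_single,
    apply_eq_zero_of_choiForm hQ hi ho, apply_eq_zero_of_choiForm hQ hi ho.symm] at this
  linear_combination this

theorem apply_eq_of_choiForm_right
    (hQ : ∀ U ∈ Matrix.unitaryGroup (Fin d) ℂ, choiForm Q U U = 0)
    (i i' : Fin d) {o o' : Fin d} (ho : o ≠ o') : Q (i, o) (i, o') = Q (i', o) (i', o') := by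
  rcases eq_or_ne i i' with rfl | hi
  · rfl
  have := choiForm_vecMulVec hQ i i' hi (Pi.single o 1) (Pi.single o' 1)
    (Pi.single i 1 + Pi.single i' 1) (Pi.single i 1 - Pi.single i' 1)
    (by simp [ho.symm]) (by simp [hi, hi.symm])
  simp only [Matrix.vecMulVec_add, Matrix.vecMulVec_sub, map_add, map_sub, LinearMap.add_apply,
    ← Matrix.single_eq_single_vecMulVec_single, choiForm_single,
    apply_eq_zero_of_choiForm hQ hi ho, apply_eq_zero_of_choiForm hQ hi.symm ho] at this
  linear_combination this

/-- Test on `(e_o ± e_o') ⊗ (e_i ± e_i')`: of the sixteen entries, those off-diagonal in both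
factors vanish, and those off-diagonal in one factor cancel in pairs by the two preceding lemmas. -/
theorem apply_add_apply_of_choiForm
    (hQ : ∀ U ∈ Matrix.unitaryGroup (Fin d) ℂ, choiForm Q U U = 0) (i i' o o' : Fin d) :
    Q (i, o) (i, o) + Q (i', o') (i', o') = Q (i, o') (i, o') + Q (i', o) (i', o) := by
  rcases eq_or_ne i i' with rfl | hi
  · ring
  rcases eq_or_ne o o' with rfl | ho
  · ring
  have := choiForm_vecMulVec hQ i i' hi (Pi.single o 1 + Pi.single o' 1)
    (Pi.single o 1 - Pi.single o' 1)
    (Pi.single i 1 + Pi.single i' 1) (Pi.single i 1 - Pi.single i' 1)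
    (by simp [ho, ho.symm]) (by simp [hi, hi.symm])
  simp only [Matrix.add_vecMulVec, Matrix.sub_vecMulVec, Matrix.vecMulVec_add,
    Matrix.vecMulVec_sub, map_add, map_sub, LinearMap.add_apply,
    ← Matrix.single_eq_single_vecMulVec_single, choiForm_single,
    apply_eq_zero_of_choiForm hQ hi ho, apply_eq_zero_of_choiForm hQ hi.symm ho,
    apply_eq_zero_of_choiForm hQ hi ho.symm, apply_eq_zero_of_choiForm hQ hi.symm ho.symm] at this
  linear_combination this + apply_eq_of_choiForm_left hQ o o' hi -
    apply_eq_of_choiForm_left hQ o o' hi.symm + apply_eq_of_choiForm_right hQ i i' ho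
    - apply_eq_of_choiForm_right hQ i i' ho.symm

/-- The relations so far come from cross terms and do not exclude a multiple of the identity;
testing `U = 1` does. -/
theorem sum_diag_eq_zero_of_choiForm
    (hQ : ∀ U ∈ Matrix.unitaryGroup (Fin d) ℂ, choiForm Q U U = 0) :
    ∑ i, Q (i, i) (i, i) = 0 := by
  have h := hQ 1 (one_mem _)
  rw [choiForm_apply, Fintype.sum_prod_type] at h
  simp only [Fintype.sum_prod_type, Matrix.one_apply] at h
  simp only [RCLike.star_def, mul_one, mul_zero, apply_ite, map_one, map_zero,
    Finset.sum_ite_eq', Finset.mem_univ, if_true, Finset.sum_ite_irrel, Finset.sum_const_zero] at h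
  rw [← h]
  refine Finset.sum_congr rfl fun i _ => ?_
  rw [Finset.sum_eq_single i]
  · intro j _ hj
    exact apply_eq_zero_of_choiForm hQ hj.symm hj.symm
  · simp

/-- An operator on `I ⊗ O` whose contraction with every unitary channel vanishes is a sum of
an operator on `I` and an operator on `O`. -/
theorem mul_apply_of_choiForm
    (hQ : ∀ U ∈ Matrix.unitaryGroup (Fin d) ℂ, choiForm Q U U = 0) (i o i' o' : Fin d) :
    d * Q (i, o) (i', o') = (if o = o' then ∑ p, Q (i, p) (i', p) else 0) +
      (if i = i' then ∑ j, Q (j, o) (j, o') else 0) := by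
  rcases eq_or_ne i i' with rfl | hi <;> rcases eq_or_ne o o' with rfl | ho
  · simp only [if_true]
    -- The parallelogram relation with second corner `(p, p)`, summed over `p`, so that the previous
    -- lemma removes the corner terms.
    have h : ∑ p, (Q (i, o) (i, o) + Q (p, p) (p, p)) =
        ∑ p, (Q (i, p) (i, p) + Q (p, o) (p, o)) :=
      Finset.sum_congr rfl fun p _ => apply_add_apply_of_choiForm hQ i p o p
    rw [Finset.sum_add_distrib, Finset.sum_add_distrib, sum_diag_eq_zero_of_choiForm hQ] at h
    simpa using h
  · simp only [ho, if_false, if_true, zero_add]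
    rw [Finset.sum_congr rfl fun j _ => apply_eq_of_choiForm_right hQ j i ho]
    simp
  · simp only [hi, if_false, if_true, add_zero]
    rw [Finset.sum_congr rfl fun j _ => apply_eq_of_choiForm_left hQ j o hi]
    simp
  · simp [hi, ho, apply_eq_zero_of_choiForm hQ hi ho]

/-- Summing the decomposition over the entries `(o, o), (o, o)` gives `d * 0` on the left and twice
the trace on the right. It makes both `A` and `B` traceless. -/
theorem sum_sum_diag_eq_zero_of_choiForm
    (hQ : ∀ U ∈ Matrix.unitaryGroup (Fin d) ℂ, choiForm Q U U = 0) :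
    ∑ i, ∑ o, Q (i, o) (i, o) = 0 := by
  have h : ∑ o, (d : ℂ) * Q (o, o) (o, o) =
      ∑ o, (∑ p, Q (o, p) (o, p) + ∑ j, Q (j, o) (j, o)) :=
    Finset.sum_congr rfl fun o _ => by simpa using mul_apply_of_choiForm hQ o o o o
  rw [← Finset.mul_sum, sum_diag_eq_zero_of_choiForm hQ, Finset.sum_add_distrib,
    Finset.sum_comm (f := fun o j => Q (j, o) (j, o))] at h
  linear_combination -h / 2

end

/-! ### Causality and depth of combs with maximally mixed later outputs -/

theorem sum_fin_cons {d n : ℕ} {M : Type*} [AddCommMonoid M] (f : (Fin (n + 1) → Fin d) → M) :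
    ∑ i, f i = ∑ j : Fin d, ∑ r : Fin n → Fin d, f (Fin.cons (α := fun _ => Fin d) j r) := by
  rw [← (Fin.consEquiv fun _ : Fin (n + 1) => Fin d).sum_comp, Fintype.sum_prod_type]
  rfl

theorem sum_fin_snoc {d n : ℕ} {M : Type*} [AddCommMonoid M] (f : (Fin (n + 1) → Fin d) → M) :
    ∑ i, f i = ∑ r : Fin n → Fin d, ∑ c : Fin d, f (Fin.snoc (α := fun _ => Fin d) r c) := by
  rw [← (Fin.snocEquiv fun _ : Fin (n + 1) => Fin d).sum_comp, Fintype.sum_prod_type,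
    Finset.sum_comm]
  rfl

/-- Causality of an operator that is maximally mixed on all outputs but the first, and that becomes
maximally mixed on the first output once all inputs but the first are traced out. -/
theorem isCausal_of_tail {d d₀ : ℕ} (hd : 0 < d) (hd₀ : 0 < d₀)
    (Y : Fin d₀ → Fin d → Fin d₀ → Fin d → ℂ) : ∀ (n : ℕ) (y c : ℂ)
    (T : PartOp d d₀ (n + 1) (n + 1))
    (R : Fin d₀ → (Fin (n + 1) → Fin d) → Fin d → Fin d₀ → (Fin (n + 1) → Fin d) → Fin d → ℂ)
    (_ : ∀ a i p r b i' p' r', T (a, i, Fin.cons p r) (b, i', Fin.cons p' r') =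
      R a i p b i' p' * if r = r' then 1 else 0)
    (_ : ∀ a j p b j' p', ∑ r : Fin n → Fin d, R a (Fin.cons j r) p b (Fin.cons j' r) p' =
      c * (Y a j b j' * if p = p' then 1 else 0))
    (_ : ∀ a b, ∑ j, Y a j b j = y * if a = b then 1 else 0), IsCausal (n + 1) T
  | 0, y, c, T, R, hT, hR, hY => by
    have hdC : (d : ℂ) ≠ 0 := by exact_mod_cast hd.ne'
    have hd₀C : (d₀ : ℂ) ≠ 0 := by exact_mod_cast hd₀.ne'
    have hT' : ∀ a j p b j' p', T (a, Fin.cons j Fin.elim0, Fin.cons p Fin.elim0)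
        (b, Fin.cons j' Fin.elim0, Fin.cons p' Fin.elim0) =
        c * (Y a j b j' * if p = p' then 1 else 0) := by
      intro a j p b j' p'
      rw [hT, ← hR, Fintype.sum_unique]
      simp [Subsingleton.elim (default : Fin 0 → Fin d) Fin.elim0]
    have hsn : ∀ (q : Fin 0 → Fin d) (x : Fin d), Fin.snoc (α := fun _ => Fin d) q x =
        Fin.cons (α := fun _ => Fin d) x Fin.elim0 := by
      intro q x
      ext k
      fin_cases k
      simp [Fin.snoc]
    have hO : ∀ a j q b j' q', traceLastO T (a, Fin.cons j Fin.elim0, q)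
        (b, Fin.cons j' Fin.elim0, q') = d * (c * Y a j b j') := by
      intro a j q b j' q'
      simp only [traceLastO, Matrix.of_apply, hsn, hT']
      simp
    refine ⟨?_, ?_⟩
    · ext ⟨a, i, o⟩ ⟨b, i', o'⟩
      induction i using Fin.consCases with | _ j i =>
      induction i' using Fin.consCases with | _ j' i' =>
      induction o using Fin.consCases with | _ p o =>
      induction o' using Fin.consCases with | _ p' o' =>
      rw [Subsingleton.elim i Fin.elim0, Subsingleton.elim i' Fin.elim0,
        Subsingleton.elim o Fin.elim0, Subsingleton.elim o' Fin.elim0, hT']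
      simp only [tensorMaxMixedO, Matrix.of_apply, hO]
      have h0 : (Fin.last 0) = 0 := rfl
      simp only [h0, Fin.cons_zero]
      split_ifs
      · field_simp
      · simp
    · have hI : ∀ x y', traceLastI (traceLastO T) x y' =
          d * (c * y) * if x.1 = y'.1 then 1 else 0 := by
        rintro ⟨a, i, o⟩ ⟨b, i', o'⟩
        simp only [traceLastI, Matrix.of_apply, hsn, hO]
        rw [← Finset.mul_sum, ← Finset.mul_sum, hY]
        ring
      show _ = _
      ext x y'
      have hxy : x = y' ↔ x.1 = y'.1 :=
        ⟨fun h => h ▸ rfl, fun h => Prod.ext h (Subsingleton.elim _ _)⟩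
      simp only [Matrix.smul_apply, Matrix.one_apply, hxy, hI, Matrix.trace, Matrix.diag_apply,
        Fintype.sum_prod_type, smul_eq_mul]
      simp
      field_simp
  | n + 1, y, c, T, R, hT, hR, hY => by
    have hdC : (d : ℂ) ≠ 0 := by exact_mod_cast hd.ne'
    have hO : ∀ a i p r b i' p' r', traceLastO T (a, i, Fin.cons p r) (b, i', Fin.cons p' r') =
        d * R a i p b i' p' * if r = r' then 1 else 0 := by
      intro a i p r b i' p' r'
      simp only [traceLastO, Matrix.of_apply, ← Fin.cons_snoc_eq_snoc_cons, hT, Fin.snoc_inj,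
        and_true]
      simp
    refine ⟨?_, ?_⟩
    · ext ⟨a, i, o⟩ ⟨b, i', o'⟩
      induction o using Fin.consCases with | _ p o =>
      induction o' using Fin.consCases with | _ p' o' =>
      induction o using Fin.snocCases with | _ o s =>
      induction o' using Fin.snocCases with | _ o' s' =>
      rw [hT]
      simp only [tensorMaxMixedO, Matrix.of_apply, Fin.cons_snoc_eq_snoc_cons, Fin.init_snoc, hO,
        Fin.snoc_last, Fin.snoc_inj]
      by_cases h1 : o = o' <;> by_cases h2 : s = s' <;> simp [h1, h2]
      field_simp
    -- Tracing out the last output gives a factor `d`, absorbed in `c`; the last input is summed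
    -- into the new `R`, so `Y` and `y` do not change.
    · refine isCausal_of_tail hd hd₀ Y n y (d * c) _
        (fun a i p b i' p' => d * ∑ s, R a (Fin.snoc (α := fun _ => Fin d) i s) p b
          (Fin.snoc (α := fun _ => Fin d) i' s) p') ?_ ?_ hY
      · intro a i p r b i' p' r'
        simp only [traceLastI, Matrix.of_apply, hO]
        rw [← Finset.sum_mul, ← Finset.mul_sum]
      · intro a j p b j' p'
        rw [← Finset.mul_sum, mul_assoc, ← hR, sum_fin_snoc]
        simp only [Fin.cons_snoc_eq_snoc_cons]

theorem replaceTail_cons {d n : ℕ} (p : Fin d) (r : Fin n → Fin d)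
    (c : {k : Fin (n + 1) // k.val ≠ 0} → Fin d) :
    replaceTail (Fin.cons (α := fun _ => Fin d) p r) c =
      Fin.cons p fun k => c ⟨k.succ, by simp⟩ := by
  ext k
  refine Fin.cases ?_ (fun k => ?_) k <;> simp [replaceTail]

theorem isDepthTwo_of_tail {d d₀ n : ℕ} (hd : 0 < d) (C : CombOp d d₀ (n + 1))
    (R : Fin d₀ → (Fin (n + 1) → Fin d) → Fin d → Fin d₀ → (Fin (n + 1) → Fin d) → Fin d → ℂ)
    (hT : ∀ a i p r b i' p' r', traceO₀ C (a, i, Fin.cons p r) (b, i', Fin.cons p' r') =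
      R a i p b i' p' * if r = r' then 1 else 0) : IsDepthTwo C := by
  have hdC : (d : ℂ) ≠ 0 := by exact_mod_cast hd.ne'
  rintro ⟨a, i, o⟩ ⟨b, i', o'⟩
  induction o using Fin.consCases with | _ p o =>
  induction o' using Fin.consCases with | _ p' o' =>
  have hiff : (∀ k : Fin (n + 1), k.val ≠ 0 → Fin.cons (α := fun _ => Fin d) p o k =
      Fin.cons (α := fun _ => Fin d) p' o' k) ↔ o = o' := by
    constructor
    · intro h
      ext k
      simpa using congrArg Fin.val (h k.succ (by simp))
    · rintro rfl k hk
      induction k using Fin.cases with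
      | zero => simp at hk
      | succ k => simp
  have hcard : Fintype.card {k : Fin (n + 1) // k.val ≠ 0} = n := by
    rw [Fintype.card_subtype_compl fun k : Fin (n + 1) => k.val = 0]
    have : Fintype.card {k : Fin (n + 1) // k.val = 0} = 1 := by
      rw [Fintype.card_eq_one_iff]
      exact ⟨⟨0, rfl⟩, fun k => Subtype.ext (Fin.ext k.2)⟩
    rw [this]; simp
  simp only [replaceTail_cons, hT, hiff]
  simp
  split_ifs
  · field_simp
  · rfl

theorem trace_of_tail {d d₀ n : ℕ} (C : CombOp d d₀ (n + 1))
    (R : Fin d₀ → (Fin (n + 1) → Fin d) → Fin d → Fin d₀ → (Fin (n + 1) → Fin d) → Fin d → ℂ)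
    (Y : Fin d₀ → Fin d → Fin d₀ → Fin d → ℂ)
    (hT : ∀ a i p r b i' p' r', traceO₀ C (a, i, Fin.cons p r) (b, i', Fin.cons p' r') =
      R a i p b i' p' * if r = r' then 1 else 0)
    (hR : ∀ a j p b j' p', ∑ r : Fin n → Fin d, R a (Fin.cons j r) p b (Fin.cons j' r) p' =
      Y a j b j' * if p = p' then 1 else 0)
    (hY : ∀ a b, ∑ j, Y a j b j = if a = b then 1 else 0) :
    C.trace = (d₀ : ℂ) * (d : ℂ) ^ (n + 1) := by
  have h1 : C.trace = ∑ a, ∑ i, ∑ o, traceO₀ C (a, i, o) (a, i, o) := by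
    simp [Matrix.trace, traceO₀, Fintype.sum_prod_type]
  have h2 : ∀ a i, ∑ o, traceO₀ C (a, i, o) (a, i, o) = d ^ n * ∑ p, R a i p a i p := by
    intro a i
    rw [sum_fin_cons]
    simp only [hT]
    simp [← Finset.mul_sum]
  have h3 : ∀ a, ∑ i, ∑ p, R a i p a i p = d := by
    intro a
    rw [Finset.sum_comm]
    simp only [sum_fin_cons (d := d) (n := n), hR, hY, if_true, mul_one]
    simp
  rw [h1]
  simp only [h2, ← Finset.mul_sum, h3]
  simp
  ring

theorem isDeterministicComb_of_tail {d d₀ n : ℕ} (hd : 0 < d) (hd₀ : 0 < d₀)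
    {C : CombOp d d₀ (n + 1)} (hC : C.PosSemidef)
    (R : Fin d₀ → (Fin (n + 1) → Fin d) → Fin d → Fin d₀ → (Fin (n + 1) → Fin d) → Fin d → ℂ)
    (Y : Fin d₀ → Fin d → Fin d₀ → Fin d → ℂ)
    (hT : ∀ a i p r b i' p' r', traceO₀ C (a, i, Fin.cons p r) (b, i', Fin.cons p' r') =
      R a i p b i' p' * if r = r' then 1 else 0)
    (hR : ∀ a j p b j' p', ∑ r : Fin n → Fin d, R a (Fin.cons j r) p b (Fin.cons j' r) p' =
      Y a j b j' * if p = p' then 1 else 0)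
    (hY : ∀ a b, ∑ j, Y a j b j = if a = b then 1 else 0) : IsDeterministicComb C :=
  ⟨hC, isCausal_of_tail hd hd₀ Y n 1 1 _ R hT (by simpa using hR) (by simpa using hY),
    trace_of_tail C R Y hT hR hY⟩

/-! ### The totally antisymmetric state -/

/-- The Levi-Civita symbol. -/
noncomputable def leviCivita {d : ℕ} (i : Fin d → Fin d) : ℂ :=
  ((1 : Matrix (Fin d) (Fin d) ℂ).submatrix i id).det

theorem star_leviCivita {d : ℕ} (i : Fin d → Fin d) : star (leviCivita i) = leviCivita i := by
  rw [leviCivita, ← Matrix.det_conjTranspose, Matrix.conjTranspose_submatrix,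
    Matrix.conjTranspose_one, ← Matrix.det_transpose, Matrix.transpose_submatrix,
    Matrix.transpose_one]

theorem leviCivita_injective {d : ℕ} {i : Fin d → Fin d} (h : leviCivita i ≠ 0) :
    Function.Injective i := by
  intro k l hkl
  by_contra hne
  exact h (Matrix.det_zero_of_row_eq hne (congrArg (fun m => (1 : Matrix (Fin d) (Fin d) ℂ) m) hkl))

theorem leviCivita_comp {d : ℕ} (σ : Equiv.Perm (Fin d)) (i : Fin d → Fin d) :
    leviCivita (fun k => σ (i k)) = (Equiv.Perm.sign σ : ℤ) * leviCivita i := by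
  rw [← Equiv.Perm.sign_symm, leviCivita, leviCivita, ← Matrix.det_permute']
  congr 1
  ext k l
  simp [Matrix.one_apply, Equiv.eq_symm_apply]

/-- Both sides are the determinant of the matrix with rows `U (o k)`, once by multilinearity in the
rows and once by multiplicativity. -/
theorem sum_leviCivita_mul_prod {d : ℕ} (U : Matrix (Fin d) (Fin d) ℂ) (o : Fin d → Fin d) :
    ∑ i, leviCivita i * ∏ k, U (o k) (i k) = U.det * leviCivita o := by
  have h1 : (U.submatrix o id).det = leviCivita o * U.det := by
    rw [leviCivita, ← Matrix.det_mul]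
    congr 1
    ext; simp [Matrix.mul_apply, Matrix.one_apply]
  have h2 : (U.submatrix o id).det = Matrix.detRowAlternating.toMultilinearMap
      (fun k => ∑ l, U (o k) l • (1 : Matrix (Fin d) (Fin d) ℂ) l) := by
    change _ = Matrix.det (Matrix.of fun k => ∑ l, U (o k) l • (1 : Matrix (Fin d) (Fin d) ℂ) l)
    congr 1
    ext k l
    simp [Matrix.one_apply]
  rw [mul_comm, ← h1, h2, MultilinearMap.map_sum]
  refine Finset.sum_congr rfl fun i _ => ?_
  rw [MultilinearMap.map_smul_univ, mul_comm, smul_eq_mul]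
  rfl

theorem leviCivita_id {d : ℕ} : leviCivita (fun k : Fin d => k) = 1 := by
  rw [leviCivita, show (fun k : Fin d => k) = id from rfl, Matrix.submatrix_id_id, Matrix.det_one]

/-- If `j, r` is a permutation, then `j' ≠ j` occurs in `r`, so `j', r` has a repetition: no term
survives. -/
theorem sum_leviCivita_cons_ne {n : ℕ} {j j' : Fin (n + 1)} (h : j ≠ j') :
    ∑ r : Fin n → Fin (n + 1), leviCivita (Fin.cons (α := fun _ => Fin (n + 1)) j r) *
      leviCivita (Fin.cons (α := fun _ => Fin (n + 1)) j' r) = 0 := by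
  refine Finset.sum_eq_zero fun r _ => ?_
  by_contra hne
  obtain ⟨h1, h2⟩ := mul_ne_zero_iff.1 hne
  obtain ⟨k, hk⟩ := (Finite.injective_iff_surjective.1 (leviCivita_injective h1)) j'
  induction k using Fin.cases with
  | zero => exact h (by simpa using hk)
  | succ k =>
    have := leviCivita_injective h2 (a₁ := k.succ) (a₂ := 0) (by simpa using hk)
    exact Fin.succ_ne_zero _ this

/-- Exchanging the values `j` and `j'` changes only the sign of the symbol, which the square
forgets. -/
theorem sum_leviCivita_cons_eq {n : ℕ} (j j' : Fin (n + 1)) :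
    ∑ r : Fin n → Fin (n + 1), leviCivita (Fin.cons (α := fun _ => Fin (n + 1)) j r) ^ 2 =
    ∑ r : Fin n → Fin (n + 1), leviCivita (Fin.cons (α := fun _ => Fin (n + 1)) j' r) ^ 2 := by
  refine Fintype.sum_equiv (Equiv.arrowCongr (Equiv.refl _) (Equiv.swap j j')) _ _ fun r => ?_
  have : (Fin.cons (α := fun _ => Fin (n + 1)) j'
      (Equiv.arrowCongr (Equiv.refl _) (Equiv.swap j j') r)) =
      fun k => Equiv.swap j j' (Fin.cons (α := fun _ => Fin (n + 1)) j r k) := by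
    ext k
    refine Fin.cases ?_ (fun k => ?_) k <;> simp
  rw [this, leviCivita_comp, mul_pow]
  have h2 : ((Equiv.Perm.sign (Equiv.swap j j') : ℤ) : ℂ) ^ 2 = 1 := by
    rcases Int.units_eq_one_or (Equiv.Perm.sign (Equiv.swap j j')) with h | h <;> simp [h]
  rw [h2, one_mul]

/-- A normalized real vector on `n + 1` copies of `ℂ^(n+1)` whose first marginal is maximally mixed
and that every `U^{⊗(n+1)}` fixes up to a phase: the totally antisymmetric state. -/
theorem exists_antisymmetric_state (n : ℕ) : ∃ α : (Fin (n + 1) → Fin (n + 1)) → ℂ,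
    (∀ i, star (α i) = α i) ∧
    (∀ j j', ∑ r : Fin n → Fin (n + 1), α (Fin.cons j r) * α (Fin.cons j' r) =
      if j = j' then ((n + 1 : ℕ) : ℂ)⁻¹ else 0) ∧
    ∀ U ∈ Matrix.unitaryGroup (Fin (n + 1)) ℂ, ∃ z : ℂ, z * star z = 1 ∧
      ∀ o, ∑ i, α i * ∏ k, U (o k) (i k) = z * α o := by
  have hre : ∀ i : Fin (n + 1) → Fin (n + 1),
      ((leviCivita i).re : ℂ) = leviCivita i := fun i =>
    Complex.conj_eq_iff_re.1 (star_leviCivita i)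
  set L : ℝ := ∑ i : Fin (n + 1) → Fin (n + 1), (leviCivita i).re ^ 2 with hL
  have hLpos : 0 < L := by
    refine Finset.sum_pos' (fun i _ => sq_nonneg _) ⟨fun k => k, Finset.mem_univ _, ?_⟩
    rw [leviCivita_id]; norm_num
  have hLC : ∑ i : Fin (n + 1) → Fin (n + 1), leviCivita i ^ 2 = (L : ℂ) := by
    rw [hL]; push_cast; simp [hre]
  obtain ⟨c, hc, hs⟩ : ∃ c : ℂ, star c = c ∧ c * c * L = 1 := by
    refine ⟨((Real.sqrt L)⁻¹ : ℝ), Complex.conj_ofReal _, ?_⟩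
    have : (Real.sqrt L)⁻¹ * (Real.sqrt L)⁻¹ * L = 1 := by
      rw [← mul_inv, Real.mul_self_sqrt hLpos.le, inv_mul_cancel₀ hLpos.ne']
    exact_mod_cast this
  have hdiag : ∀ j : Fin (n + 1), ∑ r : Fin n → Fin (n + 1),
      leviCivita (Fin.cons (α := fun _ => Fin (n + 1)) j r) ^ 2 = ((n + 1 : ℕ) : ℂ)⁻¹ * L := by
    intro j
    -- The `n + 1` partial sums are equal and add up to `L`.
    rw [← hLC, sum_fin_cons, Finset.sum_congr rfl fun j' _ => sum_leviCivita_cons_eq j' j]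
    have : ((n + 1 : ℕ) : ℂ) ≠ 0 := by exact_mod_cast n.succ_ne_zero
    rw [Finset.sum_const, Finset.card_univ, Fintype.card_fin, nsmul_eq_mul,
      inv_mul_cancel_left₀ this]
  refine ⟨fun i => c * leviCivita i, fun i => ?_, fun j j' => ?_,
    fun U hU => ⟨U.det, ?_, fun o => ?_⟩⟩
  · rw [star_mul', star_leviCivita, hc]
  · simp only [mul_mul_mul_comm c]
    rw [← Finset.mul_sum]
    split_ifs with h
    · subst h
      simp only [← sq (leviCivita _)]
      rw [hdiag]
      linear_combination ((n + 1 : ℕ) : ℂ)⁻¹ * hs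
    · rw [sum_leviCivita_cons_ne h, mul_zero]
  · rw [← Matrix.det_conjTranspose, ← Matrix.det_mul, ← Matrix.star_eq_conjTranspose,
      Matrix.mem_unitaryGroup_iff.1 hU, Matrix.det_one]
  · simp only [mul_assoc]
    rw [← Finset.mul_sum, sum_leviCivita_mul_prod]
    ring

/-! ### Contraction with the Choi operator of `U^{⊗K}` -/

section Contraction

/-- The matrix entries of `U^{⊗K}`, as a vector on input ⊗ output. -/
noncomputable def tensorPowVec {d K : ℕ} (U : Matrix (Fin d) (Fin d) ℂ) :
    (Fin K → Fin d) × (Fin K → Fin d) → ℂ :=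
  fun x => ∏ k, U (x.2 k) (x.1 k)

/-- Contraction of an operator on inputs and outputs with the Choi operator of `U^{⊗K}`. -/
noncomputable def contract {d K : ℕ} (U : Matrix (Fin d) (Fin d) ℂ) :
    Matrix ((Fin K → Fin d) × (Fin K → Fin d)) ((Fin K → Fin d) × (Fin K → Fin d)) ℂ →ₗ[ℂ] ℂ where
  toFun C := ∑ i, ∑ o, ∑ i', ∑ o', C (i, o) (i', o') *
    (tensorPowVec U (i, o) * star (tensorPowVec U (i', o')))
  map_add' C D := by simp [add_mul, Finset.sum_add_distrib]
  map_smul' c C := by simp [Finset.mul_sum, mul_assoc]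

theorem contract_apply {d K : ℕ} (U : Matrix (Fin d) (Fin d) ℂ)
    (C : Matrix ((Fin K → Fin d) × (Fin K → Fin d)) ((Fin K → Fin d) × (Fin K → Fin d)) ℂ) :
    contract U C = ∑ i, ∑ o, ∑ i', ∑ o', C (i, o) (i', o') *
      (tensorPowVec U (i, o) * star (tensorPowVec U (i', o'))) := rfl

theorem choi_unitaryOp {d : ℕ} (U : Matrix.unitaryGroup (Fin d) ℂ) (x y : Fin d × Fin d) :
    choi (unitaryOp U) x y = U.1 x.2 x.1 * star (U.1 y.2 y.1) := by
  simp only [choi, unitaryOp, Matrix.of_apply, LinearMap.mulLeftRight_apply]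
  rw [Matrix.mul_apply, Finset.sum_eq_single y.1, Matrix.mul_single_apply_same, mul_one,
    Matrix.star_apply]
  · intro k _ hk
    rw [Matrix.mul_single_apply_of_ne _ _ _ _ _ hk, zero_mul]
  · simp

theorem actChoi_unitaryOp {d d₀ K : ℕ} (C : CombOp d d₀ K) (U : Matrix.unitaryGroup (Fin d) ℂ)
    (x y : Fin d₀ × Fin d₀) :
    actChoi C (fun _ => unitaryOp U) x y = contract U.1
      (Matrix.of fun u v => C (x.1, u.1, u.2, x.2) (y.1, v.1, v.2, y.2)) := by
  simp [actChoi, contract_apply, choi_unitaryOp, tensorPowVec, Finset.prod_mul_distrib]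

theorem sum_tensorPowVec_mul_star {d K : ℕ} {U : Matrix (Fin d) (Fin d) ℂ}
    (hU : U ∈ Matrix.unitaryGroup (Fin d) ℂ) :
    ∑ i : Fin K → Fin d, ∑ o, tensorPowVec U (i, o) * star (tensorPowVec U (i, o)) = d ^ K := by
  have h1 : ∀ a : Fin d, ∑ b, U a b * star (U a b) = 1 := fun a => by
    have := congrFun (congrFun (Matrix.mem_unitaryGroup_iff.1 hU) a) a
    simpa [Matrix.mul_apply, Matrix.star_apply] using this
  rw [Finset.sum_comm]
  have h2 : ∀ o : Fin K → Fin d,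
      ∑ i, tensorPowVec U (i, o) * star (tensorPowVec U (i, o)) = 1 := by
    intro o
    have := Finset.prod_univ_sum (fun _ : Fin K => (Finset.univ : Finset (Fin d)))
      (fun k b => U (o k) b * star (U (o k) b))
    rw [Fintype.piFinset_univ] at this
    simp only [h1, Finset.prod_const_one] at this
    rw [this]
    exact Finset.sum_congr rfl fun i _ => by simp [tensorPowVec, Finset.prod_mul_distrib]
  rw [Finset.sum_congr rfl fun o _ => h2 o]
  simp

theorem contract_one {d K : ℕ} {U : Matrix (Fin d) (Fin d) ℂ}
    (hU : U ∈ Matrix.unitaryGroup (Fin d) ℂ) :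
    contract U (1 : Matrix ((Fin K → Fin d) × (Fin K → Fin d)) _ ℂ) = d ^ K := by
  rw [← sum_tensorPowVec_mul_star hU, contract_apply]
  refine Finset.sum_congr rfl fun i _ => Finset.sum_congr rfl fun o _ => ?_
  rw [← Fintype.sum_prod_type' (f := fun i' o' => (1 : Matrix _ _ ℂ) (i, o) (i', o') *
    (tensorPowVec U (i, o) * star (tensorPowVec U (i', o'))))]
  simp [Matrix.one_apply]

/-- An operator on the first input and output, extended by the identity. -/
noncomputable def extendOne {d n : ℕ} (Q : Matrix (Fin d × Fin d) (Fin d × Fin d) ℂ) :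
    Matrix ((Fin (n + 1) → Fin d) × (Fin (n + 1) → Fin d))
      ((Fin (n + 1) → Fin d) × (Fin (n + 1) → Fin d)) ℂ :=
  Matrix.of fun x y => Q (x.1 0, x.2 0) (y.1 0, y.2 0) *
    ((if Fin.tail x.1 = Fin.tail y.1 then 1 else 0) *
      (if Fin.tail x.2 = Fin.tail y.2 then 1 else 0))

/-- Each idle slot contributes the trace `d` of the Choi operator of `U`. -/
theorem contract_extendOne {d n : ℕ} {U : Matrix (Fin d) (Fin d) ℂ}
    (hU : U ∈ Matrix.unitaryGroup (Fin d) ℂ) (Q : Matrix (Fin d × Fin d) (Fin d × Fin d) ℂ) :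
    contract U (extendOne (n := n) Q) = d ^ n * choiForm Q U U := by
  rw [← sum_tensorPowVec_mul_star (K := n) hU, contract_apply, choiForm_apply]
  simp only [sum_fin_cons (d := d) (n := n), Fintype.sum_prod_type, extendOne, Matrix.of_apply,
    Fin.cons_zero, Fin.tail_cons, tensorPowVec, Fin.prod_univ_succ, Fin.cons_succ]
  rw [Finset.mul_sum]
  refine Finset.sum_congr rfl fun i _ => ?_
  rw [Finset.sum_comm, Finset.mul_sum]
  refine Finset.sum_congr rfl fun o _ => ?_
  simp only [Finset.sum_mul, Finset.mul_sum]
  rw [Finset.sum_comm (s := Finset.univ (α := Fin d))]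
  simp only [Finset.sum_comm (s := Finset.univ (α := Fin d))
    (t := Finset.univ (α := Fin n → Fin d))]
  refine Finset.sum_congr rfl fun r _ => Finset.sum_congr rfl fun s _ => ?_
  simp
  rw [Finset.sum_comm]
  exact Finset.sum_congr rfl fun _ _ => Finset.sum_congr rfl fun _ _ => by ring

/-- The slots turn `α` into `z α`, and the phases of the two sides cancel; the result no longer
depends on `U`. -/
theorem contract_antisymmetric {d n : ℕ} {U : Matrix (Fin d) (Fin d) ℂ}
    {α : (Fin (n + 1) → Fin d) → ℂ} (hα : ∀ i, star (α i) = α i) {z : ℂ} (hz : z * star z = 1)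
    (hU : ∀ o, ∑ i, α i * ∏ k, U (o k) (i k) = z * α o)
    (Z : Matrix (Fin (n + 1) → Fin d) (Fin (n + 1) → Fin d) ℂ) :
    contract U (Matrix.vecMulVec α (star α) ⊗ₖ Z) = ∑ o, ∑ o', α o * Z o o' * α o' := by
  have h : ∀ o, ∑ i, α i * tensorPowVec U (i, o) = z * α o := hU
  have h' : ∀ o, ∑ i, star (α i) * star (tensorPowVec U (i, o)) = star z * α o := fun o => by
    have := congrArg star (h o)
    simpa only [star_sum, star_mul', hα] using this
  have hswap : ∀ f : (Fin (n + 1) → Fin d) → (Fin (n + 1) → Fin d) → (Fin (n + 1) → Fin d) → ℂ,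
      ∑ i, ∑ i', ∑ o', f i i' o' = ∑ o', ∑ i', ∑ i, f i i' o' := fun f => by
    rw [Finset.sum_comm, Finset.sum_congr rfl fun i' _ => Finset.sum_comm, Finset.sum_comm]
  calc _ = ∑ o, ∑ o', Z o o' * ((∑ i, α i * tensorPowVec U (i, o)) *
        ∑ i', star (α i') * star (tensorPowVec U (i', o'))) := by
        rw [contract_apply, Finset.sum_comm]
        refine Finset.sum_congr rfl fun o _ => ?_
        simp only [Finset.sum_mul, Finset.mul_sum]
        rw [hswap]
        refine Finset.sum_congr rfl fun o' _ => Finset.sum_congr rfl fun i' _ =>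
          Finset.sum_congr rfl fun i _ => ?_
        rw [Matrix.kroneckerMap_apply, Matrix.vecMulVec_apply, Pi.star_apply]
        ring
    _ = _ := by
        simp only [h, h']
        refine Finset.sum_congr rfl fun o _ => Finset.sum_congr rfl fun o' _ => ?_
        linear_combination (Z o o' * α o * α o') * hz

end Contraction

/-! ### Positivity and completion of the recovery -/

section MatrixAlgebra
variable {m l : Type*} [Fintype m] [DecidableEq m]

theorem exists_one_sub_smul_posSemidef {H : Matrix m m ℂ} (hH : H.IsHermitian) :
    ∃ c : ℝ, 0 ≤ c ∧ ∀ t : ℝ, 0 ≤ t → t * c ≤ 1 → (1 - (t : ℂ) • H).PosSemidef := by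
  open scoped Matrix.Norms.L2Operator MatrixOrder in
  refine ⟨‖H‖, norm_nonneg _, fun t ht htc => ?_⟩
  have h1 : H ≤ algebraMap ℝ (Matrix m m ℂ) ‖H‖ :=
    IsSelfAdjoint.le_algebraMap_norm_self (show IsSelfAdjoint H from hH)
  rw [Matrix.le_iff] at h1
  have h2 : (1 - (t : ℂ) • H) = ((1 - t * ‖H‖ : ℝ) : ℂ) • (1 : Matrix m m ℂ) +
      (t : ℂ) • (algebraMap ℝ (Matrix m m ℂ) ‖H‖ - H) := by
    ext i j
    simp [Matrix.algebraMap_eq_diagonal, Matrix.diagonal_apply, Matrix.one_apply]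
    split_ifs <;> ring
  rw [h2]
  exact (Matrix.PosSemidef.one.smul (by exact_mod_cast sub_nonneg.2 htc)).add
    (h1.smul (by exact_mod_cast ht))

variable {B : Matrix m m ℂ} {K : Matrix m l ℂ}

/-- `B` compressed by the complement of `K Kᴴ`, corrected at second order. -/
noncomputable def failBlock [Fintype l] (K : Matrix m l ℂ) (B : Matrix m m ℂ) (η : ℂ) :
    Matrix m m ℂ :=
  (1 - K * K.conjTranspose) * (1 - η • B - (η ^ 2) • (B * (K * K.conjTranspose) * B)) *
    (1 - K * K.conjTranspose)

/-- With `P = K Kᴴ`, the first term is `(1 - η B) P (1 - η B)`. Since `P B P = 0`, compressing `B P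
B` by `1 - P` leaves it unchanged, so the second-order correction in `failBlock` cancels `η² B P B`
exactly. -/
theorem mul_conjTranspose_add_failBlock [Fintype l] [DecidableEq l]
    (hK : K.conjTranspose * K = 1)
    (hKB : K.conjTranspose * B * K = 0) (hB : B.IsHermitian) (η : ℝ) :
    ((1 - (η : ℂ) • B) * K) * ((1 - (η : ℂ) • B) * K).conjTranspose + failBlock K B η =
      1 - (η : ℂ) • B := by
  set P := K * K.conjTranspose with hP
  have hPP : P * P = P := by
    rw [hP, Matrix.mul_assoc, ← Matrix.mul_assoc K.conjTranspose, hK, Matrix.one_mul]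
  have hPBP : P * B * P = 0 := by
    have : P * B * P = K * (K.conjTranspose * B * K) * K.conjTranspose := by
      simp only [hP, Matrix.mul_assoc]
    rw [this, hKB]; simp
  have hE : ((1 - (η : ℂ) • B) * K) * ((1 - (η : ℂ) • B) * K).conjTranspose =
      (1 - (η : ℂ) • B) * P * (1 - (η : ℂ) • B) := by
    rw [Matrix.conjTranspose_mul, Matrix.conjTranspose_sub, Matrix.conjTranspose_smul, hB.eq]
    simp [hP, Matrix.mul_assoc]
  have h3 : P * (B * P) = 0 := by rw [← Matrix.mul_assoc]; exact hPBP
  have h4 : P * (B * (P * B)) = 0 := by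
    rw [← Matrix.mul_assoc B, ← Matrix.mul_assoc P, ← Matrix.mul_assoc P, hPBP, Matrix.zero_mul]
  rw [hE, failBlock, ← hP]
  simp only [Matrix.mul_sub, Matrix.sub_mul, Matrix.mul_one, Matrix.one_mul, Matrix.smul_mul,
    Matrix.mul_smul, Matrix.mul_assoc, hPP, h3, h4, Matrix.mul_zero, Matrix.zero_mul]
  module

theorem conjTranspose_mul_sub_mul [DecidableEq l] (hK : K.conjTranspose * K = 1)
    (hKB : K.conjTranspose * B * K = 0) (η : ℂ) :
    K.conjTranspose * ((1 - η • B) * K) = 1 := by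
  rw [Matrix.sub_mul, Matrix.mul_sub, Matrix.one_mul, hK, Matrix.smul_mul, Matrix.mul_smul,
    ← Matrix.mul_assoc, hKB]
  simp

theorem conjTranspose_mul_failBlock_mul [Fintype l] [DecidableEq l]
    (hK : K.conjTranspose * K = 1) (η : ℂ) :
    K.conjTranspose * failBlock K B η * K = 0 := by
  have : (1 - K * K.conjTranspose) * K = 0 := by
    rw [Matrix.sub_mul, Matrix.mul_assoc, hK]; simp
  rw [failBlock, Matrix.mul_assoc, Matrix.mul_assoc _ _ K, this]
  simp

theorem exists_failBlock_posSemidef [Fintype l] (hB : B.IsHermitian) (K : Matrix m l ℂ) :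
    ∃ c : ℝ, 0 ≤ c ∧ ∀ η : ℝ, 0 ≤ η → η ≤ 1 → η * c ≤ 1 → (failBlock K B η).PosSemidef := by
  have hP : (K * K.conjTranspose).PosSemidef := Matrix.posSemidef_self_mul_conjTranspose K
  have hBPB : (B * (K * K.conjTranspose) * B).PosSemidef := by
    have := hP.mul_mul_conjTranspose_same B
    rwa [hB.eq] at this
  -- For `η ≤ 1` one has `η² ≤ η`, so the quadratic correction is dominated by a linear one and a
  -- single bound on `B + B P B` suffices.
  obtain ⟨c, hc, h⟩ := exists_one_sub_smul_posSemidef (hB.add hBPB.isHermitian)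
  refine ⟨c, hc, fun η h0 h1 hη => ?_⟩
  have hQ : (1 - K * K.conjTranspose).IsHermitian :=
    Matrix.isHermitian_one.sub hP.isHermitian
  have h2 : (1 - (η : ℂ) • B - ((η : ℂ) ^ 2) • (B * (K * K.conjTranspose) * B)).PosSemidef := by
    have : 1 - (η : ℂ) • B - ((η : ℂ) ^ 2) • (B * (K * K.conjTranspose) * B) =
        (1 - (η : ℂ) • (B + B * (K * K.conjTranspose) * B)) +
        ((η - η ^ 2 : ℝ) : ℂ) • (B * (K * K.conjTranspose) * B) := by
      push_cast; module
    rw [this]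
    refine (h η h0 hη).add (hBPB.smul ?_)
    have : 0 ≤ η - η ^ 2 := by nlinarith
    exact_mod_cast this
  have := h2.mul_mul_conjTranspose_same (1 - K * K.conjTranspose)
  rwa [hQ.eq] at this

theorem one_sub_vecMulVec_posSemidef {α : m → ℂ} (hα : ∑ i, star (α i) * α i = 1) :
    (1 - Matrix.vecMulVec α (star α)).PosSemidef := by
  have h1 : Matrix.vecMulVec α (star α) * Matrix.vecMulVec α (star α) =
      Matrix.vecMulVec α (star α) := by
    rw [Matrix.vecMulVec_mul_vecMulVec]
    have : star α ⬝ᵥ α = 1 := hα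
    simp [this]
  have hH := (Matrix.posSemidef_vecMulVec_self_star α).isHermitian
  have : 1 - Matrix.vecMulVec α (star α) = (1 - Matrix.vecMulVec α (star α)) *
      (1 - Matrix.vecMulVec α (star α)).conjTranspose := by
    rw [(Matrix.isHermitian_one.sub hH).eq, Matrix.sub_mul, Matrix.mul_sub, Matrix.mul_sub, h1]
    simp
  rw [this]
  exact Matrix.posSemidef_self_mul_conjTranspose _

end MatrixAlgebra

/-! ### The marginal of the one-slot comb -/

section Marginal
variable {d d₀ : ℕ}

/-- The block of `Tr_{O₀} S` with the given labels of `I₀`, as an operator on `I₁ ⊗ O₁`. -/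
noncomputable def marginalBlock (S : CombOp d d₀ 1) (a b : Fin d₀) :
    Matrix (Fin d × Fin d) (Fin d × Fin d) ℂ :=
  Matrix.of fun x y => ∑ c, S (a, fun _ => x.1, fun _ => x.2, c) (b, fun _ => y.1, fun _ => y.2, c)

theorem star_marginalBlock {S : CombOp d d₀ 1} (hS : S.IsHermitian) (a b : Fin d₀)
    (x y : Fin d × Fin d) : star (marginalBlock S a b x y) = marginalBlock S b a y x := by
  simp only [marginalBlock, Matrix.of_apply, star_sum]
  exact Finset.sum_congr rfl fun c _ => hS.apply _ _

theorem act_single {K : ℕ} (C : CombOp d d₀ K) (Λ : Fin K → Op d d) (a b c c' : Fin d₀) :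
    act C Λ (Matrix.single a b 1) c c' = actChoi C Λ (a, c) (b, c') := by
  simp only [act, ofChoi, LinearMap.coe_mk, AddHom.coe_mk, Matrix.of_apply, Matrix.single_apply]
  rw [Finset.sum_eq_single a, Finset.sum_eq_single b]
  · simp
  · intro x _ hx
    simp [hx.symm]
  · simp
  · intro x _ hx
    simp [hx.symm]
  · simp

theorem sum_fin_one {M : Type*} [AddCommMonoid M] (f : (Fin 1 → Fin d) → M) :
    ∑ i, f i = ∑ j : Fin d, f fun _ => j := by
  rw [sum_fin_cons]
  refine Finset.sum_congr rfl fun j _ => ?_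
  rw [Fintype.sum_unique]
  congr 1
  ext k
  rw [Fin.fin_one_eq_zero k, Fin.cons_zero]

theorem actChoi_one (S : CombOp d d₀ 1) (U : Matrix.unitaryGroup (Fin d) ℂ)
    (x y : Fin d₀ × Fin d₀) :
    actChoi S (fun _ => unitaryOp U) x y = choiForm (Matrix.of fun u v =>
      S (x.1, fun _ => u.1, fun _ => u.2, x.2) (y.1, fun _ => v.1, fun _ => v.2, y.2)) U.1 U.1 := by
  rw [actChoi_unitaryOp, contract_apply, choiForm_apply]
  simp [sum_fin_one, tensorPowVec, Fintype.sum_prod_type]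

/-- Tracing out `O₀` evaluates the trace of `p f(|a⟩⟨b|)`, which trace preservation makes
independent of `f`. -/
theorem choiForm_marginalBlock {S : CombOp d d₀ 1} {U : Matrix.unitaryGroup (Fin d) ℂ} {p : ℂ}
    {f : Op d₀ d₀} (hf : ∀ ρ, (f ρ).trace = ρ.trace)
    (hact : act S (fun _ => unitaryOp U) = p • f) (a b : Fin d₀) :
    choiForm (marginalBlock S a b) U.1 U.1 = if a = b then p else 0 := by
  have h1 : choiForm (marginalBlock S a b) U.1 U.1 =
      ∑ c, actChoi S (fun _ => unitaryOp U) (a, c) (b, c) := by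
    simp only [actChoi_one, choiForm_apply, marginalBlock, Matrix.of_apply, Finset.sum_mul]
    rw [Finset.sum_comm (s := (Finset.univ : Finset (Fin d₀)))]
    refine Finset.sum_congr rfl fun x _ => ?_
    rw [Finset.sum_comm]
  have h2 : ∑ c, actChoi S (fun _ => unitaryOp U) (a, c) (b, c) =
      (act S (fun _ => unitaryOp U) (Matrix.single a b 1)).trace := by
    simp only [← act_single, Matrix.trace, Matrix.diag_apply]
  rw [h1, h2, hact, LinearMap.smul_apply, Matrix.trace_smul, hf]
  rcases eq_or_ne a b with rfl | h
  · simp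
  · simp [h]

end Marginal

/-! ### The success and draw branches -/

section Combs
variable {d d₀ n : ℕ}

/-- The comb `κ S` on the first slot, with the identity on the other slots. -/
noncomputable def padComb (κ : ℂ) (S : CombOp d d₀ 1) : CombOp d d₀ (n + 1) :=
  κ • (S ⊗ₖ (1 : Matrix ((Fin n → Fin d) × (Fin n → Fin d)) _ ℂ)).submatrix
    (fun x => ((x.1, fun _ => x.2.1 0, fun _ => x.2.2.1 0, x.2.2.2),
      (Fin.tail x.2.1, Fin.tail x.2.2.1)))
    (fun x => ((x.1, fun _ => x.2.1 0, fun _ => x.2.2.1 0, x.2.2.2),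
      (Fin.tail x.2.1, Fin.tail x.2.2.1)))

theorem padComb_posSemidef {κ : ℂ} (hκ : 0 ≤ κ) {S : CombOp d d₀ 1} (hS : S.PosSemidef) :
    (padComb (n := n) κ S).PosSemidef :=
  ((hS.kronecker Matrix.PosSemidef.one).submatrix _).smul hκ

theorem padComb_apply (κ : ℂ) (S : CombOp d d₀ 1) (a b c c' : Fin d₀)
    (i o i' o' : Fin (n + 1) → Fin d) :
    padComb κ S (a, i, o, c) (b, i', o', c') = κ * extendOne (Matrix.of fun u v =>
      S (a, fun _ => u.1, fun _ => u.2, c) (b, fun _ => v.1, fun _ => v.2, c')) (i, o) (i', o') := by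
  simp only [padComb, extendOne, Matrix.one_apply, Matrix.smul_apply, Matrix.submatrix_apply,
    Matrix.kroneckerMap_apply, Matrix.of_apply, Prod.mk.injEq, ite_and, smul_eq_mul]
  congr 2
  split_ifs <;> simp

theorem actChoi_padComb (κ : ℂ) (S : CombOp d d₀ 1) (U : Matrix.unitaryGroup (Fin d) ℂ) :
    actChoi (padComb (n := n) κ S) (fun _ => unitaryOp U) =
      (κ * d ^ n) • actChoi S (fun _ => unitaryOp U) := by
  ext x y
  have : (Matrix.of fun u v : (Fin (n + 1) → Fin d) × (Fin (n + 1) → Fin d) =>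
      padComb κ S (x.1, u.1, u.2, x.2) (y.1, v.1, v.2, y.2)) = κ • extendOne (Matrix.of fun u v =>
      S (x.1, fun _ => u.1, fun _ => u.2, x.2) (y.1, fun _ => v.1, fun _ => v.2, y.2)) := by
    ext u v
    exact padComb_apply ..
  rw [actChoi_unitaryOp, this, map_smul, contract_extendOne U.2, Matrix.smul_apply, actChoi_one,
    smul_eq_mul, smul_eq_mul, mul_assoc]

/-- The sum of `|1⟩⟩⟨⟨1| ⊗ M`, which transmits its input unchanged and applies `M` to the slots, and
of `w |α⟩⟨α| ⊗ Z`, which prepares the inputs of all slots in the state `α`. -/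
noncomputable def drawComb
    (M : Matrix ((Fin (n + 1) → Fin d) × (Fin (n + 1) → Fin d))
      ((Fin (n + 1) → Fin d) × (Fin (n + 1) → Fin d)) ℂ)
    (w : ℂ) (α : (Fin (n + 1) → Fin d) → ℂ)
    (Z : Matrix ((Fin d₀ × (Fin (n + 1) → Fin d)) × Fin d₀)
      ((Fin d₀ × (Fin (n + 1) → Fin d)) × Fin d₀) ℂ) : CombOp d d₀ (n + 1) :=
  (Matrix.vecMulVec (fun x : Fin d₀ × Fin d₀ => if x.1 = x.2 then (1 : ℂ) else 0)
      (star fun x : Fin d₀ × Fin d₀ => if x.1 = x.2 then (1 : ℂ) else 0) ⊗ₖ M).submatrix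
    (fun x => ((x.1, x.2.2.2), (x.2.1, x.2.2.1))) (fun x => ((x.1, x.2.2.2), (x.2.1, x.2.2.1))) +
  w • (Matrix.vecMulVec α (star α) ⊗ₖ Z).submatrix
    (fun x => (x.2.1, ((x.1, x.2.2.1), x.2.2.2))) (fun x => (x.2.1, ((x.1, x.2.2.1), x.2.2.2)))

variable {M : Matrix ((Fin (n + 1) → Fin d) × (Fin (n + 1) → Fin d))
      ((Fin (n + 1) → Fin d) × (Fin (n + 1) → Fin d)) ℂ}
    {w : ℂ} {α : (Fin (n + 1) → Fin d) → ℂ}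
    {Z : Matrix ((Fin d₀ × (Fin (n + 1) → Fin d)) × Fin d₀)
      ((Fin d₀ × (Fin (n + 1) → Fin d)) × Fin d₀) ℂ}

theorem drawComb_posSemidef (hM : M.PosSemidef) (hw : 0 ≤ w) (hZ : Z.PosSemidef) :
    (drawComb M w α Z).PosSemidef :=
  (((Matrix.posSemidef_vecMulVec_self_star _).kronecker hM).submatrix _).add
    ((((Matrix.posSemidef_vecMulVec_self_star _).kronecker hZ).submatrix _).smul hw)

theorem drawComb_apply (a b c c' : Fin d₀) (i o i' o' : Fin (n + 1) → Fin d) :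
    drawComb M w α Z (a, i, o, c) (b, i', o', c') =
      (if a = c then 1 else 0) * (if b = c' then 1 else 0) * M (i, o) (i', o') +
      w * (α i * star (α i') * Z ((a, o), c) ((b, o'), c')) := by
  simp only [drawComb, Matrix.add_apply, Matrix.smul_apply, Matrix.submatrix_apply,
    Matrix.kroneckerMap_apply, Matrix.vecMulVec_apply, Pi.star_apply, smul_eq_mul]
  congr 3
  split_ifs <;> simp

theorem traceO₀_drawComb (a b : Fin d₀) (i o i' o' : Fin (n + 1) → Fin d) :
    traceO₀ (drawComb M w α Z) (a, i, o) (b, i', o') =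
      (if a = b then 1 else 0) * M (i, o) (i', o') +
      w * (α i * star (α i') * ∑ c, Z ((a, o), c) ((b, o'), c)) := by
  simp only [traceO₀, Matrix.of_apply, drawComb_apply, Finset.sum_add_distrib, ← Finset.mul_sum]
  congr 1
  rw [← Finset.sum_mul]
  congr 1
  simp

theorem actChoi_drawComb (hα : ∀ i, star (α i) = α i) {z : ℂ} (hz : z * star z = 1)
    {U : Matrix.unitaryGroup (Fin d) ℂ}
    (hU : ∀ o, ∑ i, α i * ∏ k, U.1 (o k) (i k) = z * α o) (a b c c' : Fin d₀) :
    actChoi (drawComb M w α Z) (fun _ => unitaryOp U) (a, c) (b, c') =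
      (if a = c then 1 else 0) * (if b = c' then 1 else 0) * contract U.1 M +
      w * ∑ o, ∑ o', α o * Z ((a, o), c) ((b, o'), c') * α o' := by
  have : (Matrix.of fun u v : (Fin (n + 1) → Fin d) × (Fin (n + 1) → Fin d) =>
      drawComb M w α Z (a, u.1, u.2, c) (b, v.1, v.2, c')) =
      ((if a = c then 1 else 0) * (if b = c' then 1 else 0) : ℂ) • M +
      w • (Matrix.vecMulVec α (star α) ⊗ₖ Matrix.of fun o o' => Z ((a, o), c) ((b, o'), c')) := by
    ext u v
    rw [Matrix.of_apply, drawComb_apply]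
    simp only [Matrix.add_apply, Matrix.smul_apply, Matrix.kroneckerMap_apply,
      Matrix.vecMulVec_apply, Pi.star_apply, Matrix.of_apply, smul_eq_mul]
  rw [actChoi_unitaryOp, this, map_add, map_smul, map_smul, contract_antisymmetric hα hz hU]
  rfl

end Combs

/-! ### Recovery of the input after a draw -/

section Recovery
variable {d d₀ n : ℕ}

/-- The isometry that appends the state `α`. -/
noncomputable def appendState (d₀ : ℕ) (α : (Fin (n + 1) → Fin d) → ℂ) :
    Matrix (Fin d₀ × (Fin (n + 1) → Fin d)) (Fin d₀) ℂ :=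
  Matrix.of fun x a => if x.1 = a then α x.2 else 0

/-- An operator on `I₀ ⊗ O₁`, extended by the identity to all outputs. -/
noncomputable def extendOutputs (B : Matrix (Fin d₀ × Fin d) (Fin d₀ × Fin d) ℂ) :
    Matrix (Fin d₀ × (Fin (n + 1) → Fin d)) (Fin d₀ × (Fin (n + 1) → Fin d)) ℂ :=
  Matrix.of fun x y => B (x.1, x.2 0) (y.1, y.2 0) *
    if Fin.tail x.2 = Fin.tail y.2 then 1 else 0

theorem extendOutputs_isHermitian {B : Matrix (Fin d₀ × Fin d) (Fin d₀ × Fin d) ℂ}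
    (hB : B.IsHermitian) : (extendOutputs (n := n) B).IsHermitian := by
  ext x y
  rw [Matrix.conjTranspose_apply, extendOutputs, Matrix.of_apply, Matrix.of_apply, star_mul',
    hB.apply]
  by_cases h : Fin.tail x.2 = Fin.tail y.2
  · simp [h]
  · simp [h, Ne.symm h]

theorem appendState_conjTranspose_mul {l : Type*} {α : (Fin (n + 1) → Fin d) → ℂ}
    (hα : ∀ i, star (α i) = α i)
    (E : Matrix (Fin d₀ × (Fin (n + 1) → Fin d)) l ℂ) (a : Fin d₀) (c : l) :
    ((appendState d₀ α).conjTranspose * E) a c = ∑ o, α o * E (a, o) c := by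
  rw [Matrix.mul_apply, Fintype.sum_prod_type, Finset.sum_eq_single a]
  · exact Finset.sum_congr rfl fun o _ => by
      rw [Matrix.conjTranspose_apply, appendState, Matrix.of_apply, if_pos rfl, hα]
  · intro b _ hb
    refine Finset.sum_eq_zero fun o _ => ?_
    rw [Matrix.conjTranspose_apply, appendState, Matrix.of_apply, if_neg hb, star_zero, zero_mul]
  · simp

theorem mul_appendState {l : Type*} {α : (Fin (n + 1) → Fin d) → ℂ}
    (E : Matrix l (Fin d₀ × (Fin (n + 1) → Fin d)) ℂ) (x : l) (a : Fin d₀) :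
    (E * appendState d₀ α) x a = ∑ o, E x (a, o) * α o := by
  rw [Matrix.mul_apply, Fintype.sum_prod_type, Finset.sum_eq_single a]
  · exact Finset.sum_congr rfl fun o _ => by rw [appendState, Matrix.of_apply, if_pos rfl]
  · intro b _ hb
    refine Finset.sum_eq_zero fun o _ => ?_
    rw [appendState, Matrix.of_apply, if_neg hb, mul_zero]
  · simp

variable {α : (Fin (n + 1) → Fin d) → ℂ}

theorem sum_sq_of_marginal (hd : 0 < d)
    (hm : ∀ j j', ∑ r : Fin n → Fin d, α (Fin.cons j r) * α (Fin.cons j' r) =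
      if j = j' then (d : ℂ)⁻¹ else 0) : ∑ o, α o * α o = 1 := by
  have : (d : ℂ) ≠ 0 := by exact_mod_cast hd.ne'
  rw [sum_fin_cons]
  simp [hm, this]

theorem appendState_isometry (hd : 0 < d) (hα : ∀ i, star (α i) = α i)
    (hm : ∀ j j', ∑ r : Fin n → Fin d, α (Fin.cons j r) * α (Fin.cons j' r) =
      if j = j' then (d : ℂ)⁻¹ else 0) :
    (appendState d₀ α).conjTranspose * appendState d₀ α = 1 := by
  ext a c
  rw [appendState_conjTranspose_mul hα, Matrix.one_apply]
  simp only [appendState, Matrix.of_apply]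
  split_ifs
  · exact sum_sq_of_marginal hd hm
  · simp

/-- Only the first marginal of `α` enters, and it is maximally mixed: the compression is `Tr_{O₁} B
/ d`. -/
theorem appendState_compress (hα : ∀ i, star (α i) = α i)
    (hm : ∀ j j', ∑ r : Fin n → Fin d, α (Fin.cons j r) * α (Fin.cons j' r) =
      if j = j' then (d : ℂ)⁻¹ else 0)
    {B : Matrix (Fin d₀ × Fin d) (Fin d₀ × Fin d) ℂ} (hB : ∀ a b, ∑ p, B (a, p) (b, p) = 0) :
    (appendState d₀ α).conjTranspose * extendOutputs (n := n) B * appendState d₀ α = 0 := by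
  ext a b
  rw [Matrix.mul_assoc, appendState_conjTranspose_mul hα]
  have h1 : ∀ p r, (extendOutputs (n := n) B * appendState d₀ α) (a, Fin.cons p r) b =
      ∑ p', B (a, p) (b, p') * α (Fin.cons p' r) := by
    intro p r
    rw [mul_appendState, sum_fin_cons]
    simp [extendOutputs]
  rw [sum_fin_cons]
  simp only [h1, Finset.mul_sum]
  have h2 : ∀ p, ∑ r : Fin n → Fin d, ∑ p', α (Fin.cons p r) *
      (B (a, p) (b, p') * α (Fin.cons p' r)) = B (a, p) (b, p) * (d : ℂ)⁻¹ := by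
    intro p
    rw [Finset.sum_comm]
    have : ∀ p', ∑ r : Fin n → Fin d, α (Fin.cons p r) *
      (B (a, p) (b, p') * α (Fin.cons p' r)) =
        B (a, p) (b, p') * if p = p' then (d : ℂ)⁻¹ else 0 := by
      intro p'
      rw [← hm, Finset.mul_sum]
      exact Finset.sum_congr rfl fun r _ => by ring
    simp [this]
  simp only [h2]
  rw [← Finset.sum_mul, hB, zero_mul, Matrix.zero_apply]

/-- The main Kraus operator of the recovery. -/
noncomputable def recoveryBranch (d₀ : ℕ) (α : (Fin (n + 1) → Fin d) → ℂ)
    (B : Matrix (Fin d₀ × (Fin (n + 1) → Fin d)) (Fin d₀ × (Fin (n + 1) → Fin d)) ℂ) (η : ℂ) :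
    Matrix (Fin d₀ × (Fin (n + 1) → Fin d)) (Fin d₀) ℂ :=
  (1 - η • B) * appendState d₀ α

/-- The operation of a draw on the outputs: recovery of the input when the slots leave `α`
invariant. -/
noncomputable def recovery (d₀ : ℕ) (α : (Fin (n + 1) → Fin d) → ℂ)
    (B : Matrix (Fin d₀ × (Fin (n + 1) → Fin d)) (Fin d₀ × (Fin (n + 1) → Fin d)) ℂ) (η : ℂ) :
    Matrix ((Fin d₀ × (Fin (n + 1) → Fin d)) × Fin d₀)
      ((Fin d₀ × (Fin (n + 1) → Fin d)) × Fin d₀) ℂ :=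
  Matrix.vecMulVec (fun x => recoveryBranch d₀ α B η x.1 x.2)
    (star fun x => recoveryBranch d₀ α B η x.1 x.2) +
  (d₀ : ℂ)⁻¹ • (failBlock (appendState d₀ α) B η ⊗ₖ 1)

variable {B : Matrix (Fin d₀ × (Fin (n + 1) → Fin d)) (Fin d₀ × (Fin (n + 1) → Fin d)) ℂ}

theorem recovery_posSemidef {η : ℂ} (h : (failBlock (appendState d₀ α) B η).PosSemidef) :
    (recovery d₀ α B η).PosSemidef :=
  (Matrix.posSemidef_vecMulVec_self_star _).add
    ((h.kronecker Matrix.PosSemidef.one).smul (by simp))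

/-- The Kraus branch contributes `E Eᴴ` with `E = (1 - η B) K`. The failure branch outputs the
maximally mixed state, so it contributes exactly `failBlock`. -/
theorem sum_recovery (hd₀ : 0 < d₀) (hB : B.IsHermitian)
    (hK : (appendState d₀ α).conjTranspose * appendState d₀ α = 1)
    (hKB : (appendState d₀ α).conjTranspose * B * appendState d₀ α = 0) (η : ℝ)
    (x y : Fin d₀ × (Fin (n + 1) → Fin d)) :
    ∑ c, recovery d₀ α B η (x, c) (y, c) = (1 - (η : ℂ) • B) x y := by
  have hd₀C : (d₀ : ℂ) ≠ 0 := by exact_mod_cast hd₀.ne'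
  rw [← mul_conjTranspose_add_failBlock hK hKB hB η, Matrix.add_apply, ← recoveryBranch,
    Matrix.mul_apply]
  simp only [recovery, Matrix.add_apply, Matrix.smul_apply, Matrix.kroneckerMap_apply,
    Matrix.vecMulVec_apply, Matrix.one_apply_eq, Finset.sum_add_distrib, Pi.star_apply,
    Matrix.conjTranspose_apply]
  congr 1
  simp [-Complex.coe_smul, hd₀C]

/-- On outputs in the state `α`, the Kraus branch acts as `Kᴴ (1 - η B) K = 1`, and the failure
branch never occurs because it vanishes on the range of `K`. -/
theorem sum_sum_recovery (hα : ∀ i, star (α i) = α i)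
    (hK : (appendState d₀ α).conjTranspose * appendState d₀ α = 1)
    (hKB : (appendState d₀ α).conjTranspose * B * appendState d₀ α = 0) (η : ℂ)
    (a b c c' : Fin d₀) :
    ∑ o, ∑ o', α o * recovery d₀ α B η ((a, o), c) ((b, o'), c') * α o' =
      (if a = c then 1 else 0) * if b = c' then 1 else 0 := by
  have h1 : ∀ a c, ∑ o, α o * recoveryBranch d₀ α B η (a, o) c =
      if a = c then 1 else 0 := by
    intro a c
    rw [← appendState_conjTranspose_mul hα, recoveryBranch, conjTranspose_mul_sub_mul hK hKB,
      Matrix.one_apply]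
  have h1' : ∀ b c', ∑ o', star (recoveryBranch d₀ α B η (b, o') c') * α o' =
      if b = c' then 1 else 0 := by
    intro b c'
    have := congrArg star (h1 b c')
    simp only [star_sum, star_mul', hα, apply_ite star, star_one, star_zero] at this
    rw [← this]
    exact Finset.sum_congr rfl fun _ _ => mul_comm _ _
  have h2 : ∑ o, ∑ o', α o * failBlock (appendState d₀ α) B η (a, o) (b, o') * α o' = 0 := by
    have := congrFun (congrFun (conjTranspose_mul_failBlock_mul (B := B) hK η) a) b
    rw [mul_appendState] at this
    simp only [appendState_conjTranspose_mul hα, Finset.sum_mul] at this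
    rw [Finset.sum_comm, this, Matrix.zero_apply]
  have h3 : ∀ o o', α o * recovery d₀ α B η ((a, o), c) ((b, o'), c') * α o' =
      (α o * recoveryBranch d₀ α B η (a, o) c) *
        (star (recoveryBranch d₀ α B η (b, o') c') * α o') +
      (d₀ : ℂ)⁻¹ * (1 : Matrix (Fin d₀) (Fin d₀) ℂ) c c' *
        (α o * failBlock (appendState d₀ α) B η (a, o) (b, o') * α o') := by
    intro o o'
    simp only [recovery, Matrix.add_apply, Matrix.smul_apply, Matrix.kroneckerMap_apply,
      Matrix.vecMulVec_apply, Pi.star_apply, smul_eq_mul]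
    ring
  simp only [h3, Finset.sum_add_distrib, ← Finset.mul_sum, h2, mul_zero, add_zero]
  rw [← Finset.sum_mul, h1, h1']

end Recovery

/-! ### Assembly of the success-or-draw comb -/

/-- Subtracting the reference block `a₀` on the diagonal removes `p U`, so every difference block is
annihilated by all unitary channels and splits. -/
theorem exists_marginalBlock_decomposition {d d₀ : ℕ} (hd : 0 < d) {S : CombOp d d₀ 1}
    (hS : S.IsHermitian) (p : Matrix.unitaryGroup (Fin d) ℂ → ℂ)
    (hp : ∀ U : Matrix.unitaryGroup (Fin d) ℂ, ∀ a b,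
      choiForm (marginalBlock S a b) U.1 U.1 = if a = b then p U else 0) (a₀ : Fin d₀) :
    ∃ (A : Fin d₀ → Fin d → Fin d₀ → Fin d → ℂ) (B : Matrix (Fin d₀ × Fin d) (Fin d₀ × Fin d) ℂ),
      B.IsHermitian ∧ (∀ a b, ∑ q, B (a, q) (b, q) = 0) ∧ (∀ a b, ∑ j, A a j b j = 0) ∧
      ∀ a b j q j' q', marginalBlock S a b (j, q) (j', q') =
        (if a = b then 1 else 0) * marginalBlock S a₀ a₀ (j, q) (j', q') +
        (if q = q' then 1 else 0) * A a j b j' + (if j = j' then 1 else 0) * B (a, q) (b, q') := by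
  have hdC : (d : ℂ) ≠ 0 := by exact_mod_cast hd.ne'
  let D : Fin d₀ → Fin d₀ → Matrix (Fin d × Fin d) (Fin d × Fin d) ℂ := fun a b =>
    Matrix.of fun x y => marginalBlock S a b x y -
      (if a = b then 1 else 0) * marginalBlock S a₀ a₀ x y
  have hDapp : ∀ a b x y, D a b x y = marginalBlock S a b x y -
      (if a = b then 1 else 0) * marginalBlock S a₀ a₀ x y := fun _ _ _ _ => rfl
  have hD : ∀ a b, ∀ U ∈ Matrix.unitaryGroup (Fin d) ℂ, choiForm (D a b) U U = 0 := by
    intro a b U hU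
    have : choiForm (D a b) U U = choiForm (marginalBlock S a b) U U -
        (if a = b then 1 else 0) * choiForm (marginalBlock S a₀ a₀) U U := by
      simp only [choiForm_apply, hDapp, sub_mul, Finset.sum_sub_distrib, Finset.mul_sum, mul_assoc]
    rw [this, hp ⟨U, hU⟩, hp ⟨U, hU⟩]
    simp
  have hDstar : ∀ a b x y, star (D a b x y) = D b a y x := by
    intro a b x y
    rw [hDapp, hDapp, star_sub, star_mul', star_marginalBlock hS, star_marginalBlock hS]
    by_cases h : a = b
    · simp [h]
    · simp [h, Ne.symm h]
  refine ⟨fun a j b j' => (d : ℂ)⁻¹ * ∑ q, D a b (j, q) (j', q),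
    Matrix.of fun x y => (d : ℂ)⁻¹ * ∑ j, D x.1 y.1 (j, x.2) (j, y.2), ?_, ?_, ?_, ?_⟩
  · ext x y
    simp only [Matrix.conjTranspose_apply, Matrix.of_apply, star_mul', star_sum, hDstar]
    simp
  · intro a b
    simp only [Matrix.of_apply]
    rw [← Finset.mul_sum, Finset.sum_comm, sum_sum_diag_eq_zero_of_choiForm (hD a b), mul_zero]
  · intro a b
    rw [← Finset.mul_sum, sum_sum_diag_eq_zero_of_choiForm (hD a b), mul_zero]
  · intro a b j q j' q'
    have h := mul_apply_of_choiForm (hD a b) j q j' q'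
    have h' : D a b (j, q) (j', q') = (d : ℂ)⁻¹ * ((if q = q' then 1 else 0) *
        ∑ q, D a b (j, q) (j', q) + (if j = j' then 1 else 0) * ∑ j, D a b (j, q) (j, q')) := by
      rw [eq_inv_mul_iff_mul_eq₀ hdC, h]
      split_ifs <;> simp
    rw [hDapp] at h'
    simp only [Matrix.of_apply]
    linear_combination h'

theorem ofChoi_smul {m n : ℕ} (c : ℂ) (M : Matrix (Fin m × Fin n) (Fin m × Fin n) ℂ) :
    ofChoi (c • M) = c • ofChoi M := by
  ext1 ρ
  ext b b'
  simp [ofChoi, Finset.mul_sum, mul_assoc]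

theorem ofChoi_eq_smul_id {m : ℕ} (c : ℂ) (M : Matrix (Fin m × Fin m) (Fin m × Fin m) ℂ)
    (hM : ∀ a b a' b', M (a, b) (a', b') =
      (if a = b then 1 else 0) * (if a' = b' then 1 else 0) * c) :
    ofChoi M = c • LinearMap.id := by
  ext1 ρ
  ext b b'
  simp [ofChoi, hM]

/-- Success-or-draw for combs with `n + 1` slots, given a state `α` of the slot inputs that is
invariant under `U^{⊗(n+1)}` up to phases and whose first marginal is maximally mixed. -/
theorem exists_success_or_draw {d d₀ n : ℕ} (hd : 0 < d) (hd₀ : 0 < d₀)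
    {α : (Fin (n + 1) → Fin d) → ℂ} (hα : ∀ i, star (α i) = α i)
    (hm : ∀ j j', ∑ r : Fin n → Fin d, α (Fin.cons j r) * α (Fin.cons j' r) =
      if j = j' then (d : ℂ)⁻¹ else 0)
    (hinv : ∀ U ∈ Matrix.unitaryGroup (Fin d) ℂ, ∃ z : ℂ, z * star z = 1 ∧
      ∀ o, ∑ i, α i * ∏ k, U (o k) (i k) = z * α o)
    {S₁ : CombOp d d₀ 1} (hS₁ : S₁.PosSemidef) (p : Matrix.unitaryGroup (Fin d) ℂ → ℂ)
    (hp : ∀ U : Matrix.unitaryGroup (Fin d) ℂ, ∀ a b,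
      choiForm (marginalBlock S₁ a b) U.1 U.1 = if a = b then p U else 0) :
    ∃ ε : ℝ, 0 < ε ∧ ∃ S N : CombOp d d₀ (n + 1), S.PosSemidef ∧ N.PosSemidef ∧
      IsDeterministicComb (S + N) ∧ IsDepthTwo (S + N) ∧
      ∀ U : Matrix.unitaryGroup (Fin d) ℂ,
        act S (fun _ => unitaryOp U) = (ε : ℂ) • act S₁ (fun _ => unitaryOp U) ∧
        act N (fun _ => unitaryOp U) = (1 - ε * p U : ℂ) • LinearMap.id := by
  have hdC : (d : ℂ) ≠ 0 := by exact_mod_cast hd.ne'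
  have hdR : (0 : ℝ) < d := by exact_mod_cast hd
  obtain ⟨A, B, hB, hBtr, hAtr, hT⟩ :=
    exists_marginalBlock_decomposition hd hS₁.isHermitian p hp ⟨0, hd₀⟩
  set T₀ := marginalBlock S₁ ⟨0, hd₀⟩ ⟨0, hd₀⟩ with hT₀
  have hT₀herm : (extendOne (n := n) T₀).IsHermitian := by
    ext x y
    simp only [Matrix.conjTranspose_apply, extendOne, Matrix.of_apply, star_mul', hT₀,
      star_marginalBlock hS₁.isHermitian]
    simp only [eq_comm (a := Fin.tail y.1), eq_comm (a := Fin.tail y.2)]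
    congr 1
    split_ifs <;> simp
  have hK := appendState_isometry (d₀ := d₀) hd hα hm
  have hKB := appendState_compress hα hm hBtr
  have hBh : (extendOutputs (n := n) B).IsHermitian := extendOutputs_isHermitian hB
  obtain ⟨c₁, hc₁, hfail⟩ := exists_failBlock_posSemidef hBh (appendState d₀ α)
  obtain ⟨c₂, hc₂, hsub⟩ := exists_one_sub_smul_posSemidef hT₀herm
  -- The term `2 w • 1` of `M` contracts to `1`. Half of it pays for subtracting `w |α⟩⟨α| ⊗ 1`, the
  -- other half for subtracting `κ T₀`.
  obtain ⟨w, hw, hwd⟩ : ∃ w : ℝ, 0 < w ∧ 2 * w * d ^ (n + 1) = 1 :=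
    ⟨((d : ℝ) ^ (n + 1))⁻¹ / 2, by positivity, by field_simp⟩
  -- With `η = d ε / w` and `κ = ε / d ^ n`, the first two bounds make `failBlock` positive and the
  -- third makes `M` positive.
  obtain ⟨ε, hε, hε1, hε2, hε3⟩ : ∃ ε : ℝ, 0 < ε ∧ d * ε / w ≤ 1 ∧ d * ε / w * c₁ ≤ 1 ∧
      ε / d ^ n / w * c₂ ≤ 1 := by
    set k : ℝ := d / w + d / w * c₁ + 1 / d ^ n / w * c₂ + 1 with hk
    have h1 : 0 < (d : ℝ) / w := by positivity
    have h2 : 0 ≤ (d : ℝ) / w * c₁ := by positivity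
    have h3 : 0 ≤ 1 / (d : ℝ) ^ n / w * c₂ := by positivity
    have hk0 : 0 < k := by positivity
    refine ⟨k⁻¹, by positivity, ?_, ?_, ?_⟩
    · rw [show d * k⁻¹ / w = (d / w) / k by ring, div_le_one hk0]; linarith
    · rw [show d * k⁻¹ / w * c₁ = (d / w * c₁) / k by ring, div_le_one hk0]; linarith
    · rw [show k⁻¹ / d ^ n / w * c₂ = (1 / d ^ n / w * c₂) / k by ring, div_le_one hk0]; linarith
  obtain ⟨κ, hκ⟩ : ∃ κ : ℝ, κ = ε / d ^ n := ⟨_, rfl⟩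
  obtain ⟨η, hη⟩ : ∃ η : ℝ, η = d * ε / w := ⟨_, rfl⟩
  rw [← hη] at hε1 hε2
  rw [← hκ] at hε3
  have hκ0 : 0 ≤ κ := by rw [hκ]; positivity
  have hη0 : 0 ≤ η := by rw [hη]; positivity
  have hκd : (κ : ℂ) * d ^ n = ε := by
    have : κ * d ^ n = ε := by rw [hκ]; field_simp
    exact_mod_cast this
  have hwη : (w : ℂ) * η = d * ε := by
    have : w * η = d * ε := by rw [hη]; field_simp
    exact_mod_cast this
  have hwdC : 2 * (w : ℂ) * d ^ (n + 1) = 1 := by exact_mod_cast hwd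
  have hw0 : (0 : ℂ) ≤ w := by exact_mod_cast hw.le
  set M : Matrix ((Fin (n + 1) → Fin d) × (Fin (n + 1) → Fin d))
      ((Fin (n + 1) → Fin d) × (Fin (n + 1) → Fin d)) ℂ :=
    (2 * w : ℂ) • 1 - (w : ℂ) • (Matrix.vecMulVec α (star α) ⊗ₖ 1) -
      (κ : ℂ) • extendOne T₀ with hMdef
  have hM : M.PosSemidef := by
    have h1 : M = (w : ℂ) • ((1 - Matrix.vecMulVec α (star α)) ⊗ₖ 1) +
        (w : ℂ) • (1 - ((κ / w : ℝ) : ℂ) • extendOne T₀) := by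
      have h2 : (1 - Matrix.vecMulVec α (star α)) ⊗ₖ
          (1 : Matrix (Fin (n + 1) → Fin d) (Fin (n + 1) → Fin d) ℂ) =
          1 - Matrix.vecMulVec α (star α) ⊗ₖ 1 := by
        rw [sub_eq_add_neg, Matrix.add_kronecker, Matrix.one_kronecker_one, ← neg_one_smul ℂ,
          Matrix.smul_kronecker]
        module
      have h3 : (w : ℂ) * ((κ / w : ℝ) : ℂ) = κ := by
        have : w * (κ / w) = κ := by field_simp
        exact_mod_cast this
      rw [h2, hMdef, smul_sub, smul_sub, smul_smul, h3]
      module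
    rw [h1]
    refine Matrix.PosSemidef.add (Matrix.PosSemidef.smul (Matrix.PosSemidef.kronecker
      (one_sub_vecMulVec_posSemidef ?_) Matrix.PosSemidef.one) hw0)
      (Matrix.PosSemidef.smul (hsub _ (by positivity) hε3) hw0)
    simp only [hα]
    exact sum_sq_of_marginal hd hm
  have hS : (padComb (n := n) (κ : ℂ) S₁).PosSemidef :=
    padComb_posSemidef (by exact_mod_cast hκ0) hS₁
  have hN : (drawComb M (w : ℂ) α (recovery d₀ α (extendOutputs B) η)).PosSemidef :=
    drawComb_posSemidef hM hw0 (recovery_posSemidef (hfail η hη0 hε1 hε2))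
  -- The two `w |α⟩⟨α| ⊗ 1` contributions cancel between `M` and the recovery, and `-κ T₀` combines
  -- with the success branch into the difference blocks.
  have htr : ∀ a i q r b i' q' r', traceO₀ (padComb (n := n) (κ : ℂ) S₁ +
      drawComb M (w : ℂ) α (recovery d₀ α (extendOutputs B) η)) (a, i, Fin.cons q r)
        (b, i', Fin.cons q' r') =
      (κ * (if Fin.tail i = Fin.tail i' then 1 else 0) * (marginalBlock S₁ a b (i 0, q) (i' 0, q') -
        (if a = b then 1 else 0) * T₀ (i 0, q) (i' 0, q')) +
      (if a = b then 1 else 0) * (2 * w * (if i = i' then 1 else 0) * (if q = q' then 1 else 0)) -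
      w * η * (α i * α i') * B (a, q) (b, q')) * (if r = r' then 1 else 0) := by
    intro a i q r b i' q' r'
    have h1 : traceO₀ (padComb (n := n) (κ : ℂ) S₁) (a, i, Fin.cons q r) (b, i', Fin.cons q' r') =
        κ * (marginalBlock S₁ a b (i 0, q) (i' 0, q') *
          ((if Fin.tail i = Fin.tail i' then 1 else 0) * if r = r' then 1 else 0)) := by
      simp only [traceO₀, Matrix.of_apply, padComb_apply, extendOne, Fin.cons_zero, Fin.tail_cons,
        marginalBlock, Finset.sum_mul, Finset.mul_sum]
    have h2 : ∀ x y : (Fin (n + 1) → Fin d) × (Fin (n + 1) → Fin d), M x y =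
        2 * w * (1 : Matrix _ _ ℂ) x y - w * (α x.1 * α y.1 * (1 : Matrix _ _ ℂ) x.2 y.2) -
          κ * extendOne T₀ x y := by
      intro x y
      simp only [hMdef, Matrix.sub_apply, Matrix.smul_apply, Matrix.kroneckerMap_apply,
        Matrix.vecMulVec_apply, Pi.star_apply, hα, smul_eq_mul]
    have h3 : (1 : Matrix (Fin (n + 1) → Fin d) (Fin (n + 1) → Fin d) ℂ)
        (Fin.cons (α := fun _ => Fin d) q r) (Fin.cons (α := fun _ => Fin d) q' r') =
        (if q = q' then 1 else 0) * if r = r' then 1 else 0 := by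
      simp only [Matrix.one_apply, Fin.cons_inj, ite_and, ite_mul, one_mul, zero_mul]
    have h4 : (1 : Matrix ((Fin (n + 1) → Fin d) × (Fin (n + 1) → Fin d)) _ ℂ)
        (i, Fin.cons (α := fun _ => Fin d) q r)
        (i', Fin.cons (α := fun _ => Fin d) q' r') =
        (if i = i' then 1 else 0) * ((if q = q' then 1 else 0) * if r = r' then 1 else 0) := by
      simp only [Matrix.one_apply, Prod.mk.injEq, Fin.cons_inj, ite_and, ite_mul, one_mul, zero_mul]
    have h5 : (1 : Matrix (Fin d₀ × (Fin (n + 1) → Fin d)) _ ℂ)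
        (a, Fin.cons (α := fun _ => Fin d) q r)
        (b, Fin.cons (α := fun _ => Fin d) q' r') =
        (if a = b then 1 else 0) * ((if q = q' then 1 else 0) * if r = r' then 1 else 0) := by
      simp only [Matrix.one_apply, Prod.mk.injEq, Fin.cons_inj, ite_and, ite_mul, one_mul, zero_mul]
    have hadd : ∀ (C C' : CombOp d d₀ (n + 1)) x y,
        traceO₀ (C + C') x y = traceO₀ C x y + traceO₀ C' x y := by
      intro C C' x y
      simp [traceO₀, Finset.sum_add_distrib]
    rw [hadd, h1, traceO₀_drawComb, h2, h4, h3, sum_recovery hd₀ hBh hK hKB, Matrix.sub_apply,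
      Matrix.smul_apply, h5, hα]
    simp only [extendOne, extendOutputs, Matrix.of_apply, Fin.cons_zero, Fin.tail_cons, smul_eq_mul]
    ring
  have hR : ∀ a j q b j' q', ∑ r : Fin n → Fin d,
      (κ * (if Fin.tail (Fin.cons (α := fun _ => Fin d) j r) =
          Fin.tail (Fin.cons (α := fun _ => Fin d) j' r) then 1 else 0) *
        (marginalBlock S₁ a b (Fin.cons (α := fun _ => Fin d) j r 0, q)
          (Fin.cons (α := fun _ => Fin d) j' r 0, q') -
        (if a = b then 1 else 0) * T₀ (Fin.cons (α := fun _ => Fin d) j r 0, q)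
          (Fin.cons (α := fun _ => Fin d) j' r 0, q')) +
      (if a = b then 1 else 0) * (2 * w * (if Fin.cons (α := fun _ => Fin d) j r =
        Fin.cons (α := fun _ => Fin d) j' r then 1 else 0) * (if q = q' then 1 else 0)) -
      w * η * (α (Fin.cons j r) * α (Fin.cons j' r)) * B (a, q) (b, q')) =
      ((d : ℂ)⁻¹ * ((if a = b then 1 else 0) * if j = j' then 1 else 0) + ε * A a j b j') *
        if q = q' then 1 else 0 := by
    intro a j q b j' q'
    have h1 : 2 * (w : ℂ) * d ^ n = (d : ℂ)⁻¹ := by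
      refine eq_inv_of_mul_eq_one_left ?_
      linear_combination hwdC
    have h2 : (d : ℂ) * (d : ℂ)⁻¹ = 1 := mul_inv_cancel₀ hdC
    rw [Finset.sum_sub_distrib, ← Finset.sum_mul, ← Finset.mul_sum, hm]
    simp only [Fin.cons_zero, Fin.tail_cons, if_true, Fin.cons_inj, and_true, Finset.sum_const,
      Finset.card_univ, Fintype.card_pi, Finset.prod_const, Fintype.card_fin, nsmul_eq_mul, hT,
      Nat.cast_pow, hwη]
    have h3 : (if j = j' then (d : ℂ)⁻¹ else 0) = (d : ℂ)⁻¹ * if j = j' then 1 else 0 := by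
      split_ifs <;> simp
    rw [h3]
    -- The success branch yields `κ d ^ n = ε` times `A ⊗ 1 + 1 ⊗ B`; the recovery yields `-w η / d
    -- = -ε` times `1 ⊗ B`, leaving only the `A`-term.
    linear_combination ((if q = q' then 1 else 0) * A a j b j' +
      (if j = j' then 1 else 0) * B (a, q) (b, q')) * hκd +
      (if a = b then 1 else 0) * (if j = j' then 1 else 0) * (if q = q' then 1 else 0) * h1 -
      ε * (if j = j' then 1 else 0) * B (a, q) (b, q') * h2
  have hY : ∀ a b, ∑ j, ((d : ℂ)⁻¹ * ((if a = b then 1 else 0) * if j = j then 1 else 0) +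
      ε * A a j b j) = if a = b then 1 else 0 := by
    intro a b
    rw [Finset.sum_add_distrib, ← Finset.mul_sum, ← Finset.mul_sum (a := (ε : ℂ)), hAtr]
    simp [hdC]
  refine ⟨ε, hε, _, _, hS, hN, isDeterministicComb_of_tail hd hd₀ (hS.add hN)
    (fun a i q b i' q' => κ * (if Fin.tail i = Fin.tail i' then 1 else 0) *
        (marginalBlock S₁ a b (i 0, q) (i' 0, q') -
        (if a = b then 1 else 0) * T₀ (i 0, q) (i' 0, q')) +
      (if a = b then 1 else 0) * (2 * w * (if i = i' then 1 else 0) * (if q = q' then 1 else 0)) -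
      w * η * (α i * α i') * B (a, q) (b, q'))
    (fun a j b j' => (d : ℂ)⁻¹ * ((if a = b then 1 else 0) * if j = j' then 1 else 0) +
      ε * A a j b j') htr hR hY, isDepthTwo_of_tail hd _ _ htr, fun U => ⟨?_, ?_⟩⟩
  · rw [act, actChoi_padComb, ofChoi_smul, hκd, act]
  · obtain ⟨z, hz, hU⟩ := hinv U.1 U.2
    refine ofChoi_eq_smul_id _ _ fun a c b c' => ?_
    rw [actChoi_drawComb hα hz hU, sum_sum_recovery hα hK hKB, hMdef, map_sub, map_sub, map_smul,
      map_smul, map_smul, contract_one U.2, contract_antisymmetric hα hz hU,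
      contract_extendOne U.2, hp, if_pos rfl]
    have h1 : ∑ o, ∑ o', α o * (1 : Matrix (Fin (n + 1) → Fin d) (Fin (n + 1) → Fin d) ℂ) o o' *
        α o' = 1 := by
      rw [← sum_sq_of_marginal hd hm]
      simp [Matrix.one_apply]
    rw [h1]
    simp only [smul_eq_mul]
    -- `M` contracts to `1 - w - ε p U`, and the recovery supplies the missing `w`.
    linear_combination (if a = c then 1 else 0) * (if b = c' then 1 else 0) * (hwdC - p U * hκd)

end QComb

theorem theorem1 (d d₀ : ℕ) (hd : 0 < d) (hd₀ : 0 < d₀)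
    (S₁ : QComb.CombOp d d₀ 1) (hS₁ : QComb.IsProbabilisticComb S₁)
    (p : Matrix.unitaryGroup (Fin d) ℂ → ℝ)
    (f : Matrix.unitaryGroup (Fin d) ℂ → QComb.Op d₀ d₀)
    (hf : ∀ U, QComb.IsCPTP (f U))
    (hact : ∀ U, QComb.act S₁ (fun _ => QComb.unitaryOp U) = (p U : ℂ) • f U) :
    ∃ ε : ℝ, 0 < ε ∧ ∃ S N : QComb.CombOp d d₀ d,
      QComb.IsProbabilisticComb S ∧ QComb.IsProbabilisticComb N ∧
      QComb.IsDeterministicComb (S + N) ∧ QComb.IsDepthTwo (S + N) ∧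
      ∀ U : Matrix.unitaryGroup (Fin d) ℂ,
        QComb.act S (fun _ => QComb.unitaryOp U) = ((ε * p U : ℝ) : ℂ) • f U ∧
        QComb.act N (fun _ => QComb.unitaryOp U) = ((1 - ε * p U : ℝ) : ℂ) • LinearMap.id := by
  obtain ⟨n, rfl⟩ : ∃ n, d = n + 1 := ⟨d - 1, by omega⟩
  obtain ⟨α, hα, hm, hinv⟩ := QComb.exists_antisymmetric_state n
  obtain ⟨ε, hε, S, N, hS, hN, hdet, hdepth, hSN⟩ := QComb.exists_success_or_draw hd hd₀ hα hm hinv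
    hS₁.1 (fun U => (p U : ℂ)) fun U => QComb.choiForm_marginalBlock (hf U).2 (hact U)
  -- Each branch is positive and completes the other to the deterministic comb.
  refine ⟨ε, hε, S, N, ⟨hS, N, hN, hdet⟩, ⟨hN, S, hS, add_comm S N ▸ hdet⟩, hdet, hdepth,
    fun U => ⟨?_, ?_⟩⟩
  · rw [(hSN U).1, hact, smul_smul]
    push_cast
    rfl
  · rw [(hSN U).2]
    push_cast
    rfl
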